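/- **Data.** Let $f:\mathbb R^n\times\mathbb R^d\to\mathbb R^n$, $g_i:\mathbb R^n\to\mathbb R$ $(i\le m)$, $\nu_i:\mathbb R^n\to\mathbb R$ $(i\le s)$, $A\subset\mathbb R^d$, $x_0\in\mathbb R^n$, $\Xi_x\subset\mathbb R^n$, $\Xi_T\subset\mathbb R$, $\varphi:\mathbb R^n\times[0,\infty)\to(-\infty,\infty]$ and $\ell:[0,\infty)\times\mathbb R^{4n+d}\to(-\infty,\infty]$ be given. Put $C_i=\{g_i\ge0\}$, $C=\bigcap_iC_i$, $U_i=\{\nu_i\le0\}$, $U=\bigcap_iU_i$, and $F(x,u,a)=N_C(x-u)-f(x,a)$, where $N_\Omega(y)$ is the limiting (Mordukhovich) normal cone: for $y\in\Omega$, $v\in N_\Omega(y)$ iff $v=\lim\alpha_i(y_i-w_i)$ for some $y_i\to y$, $\alpha_i\ge0$ and $w_i$ in the Euclidean projection of $y_i$ onto $\Omega$; $N_\Omega(y)=\emptyset$ for $y\notin\Omega$. A quadruple $(x,u,a,T)$ with $T\ge0$, $x,u\in W^{1,2}([0,T];\mathbb R^n)$, $a\in L^2([0,T];\mathbb R^d)$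 is *feasible* if $(-\dot x,u,a)\in F(x,u,a)\times U\times A$ a.e. on $[0,T]$, $x(0)=x_0\in C+u(0)$ and $(x(T),T)\in\Xi_x\times\Xi_T$. **Assumptions.** Let $(\bar x,\bar u,\bar a,\bar T)$, $\bar T>0$, be a feasible quadruple. * (H1) $\|f(x_1,a_1)-f(x_2,a_2)\|\le L_f(\|x_1-x_2\|+\|a_1-a_2\|)$ with $L_f>0$, and for some $M>0$, $\|f(x,a)\|\le M(1+\|x\|)$ for all $a\in\mathbb R^d$ and $x\in\bigcup_{t\in[0,\bar T]}(C+\bar u(t))$. * (H2) The $g_i$ are convex and $C^2$. There are $c,M_1,M_2,M_3>0$ and open $V_i\supset C_i$ whose complements have Hausdorff distance $>c$ from $C_i$, with $M_1\le\|\nabla g_i\|\le M_2$ and $\|\nabla^2g_i\|\le M_3$ on $V_i$. There are $\beta,\rho>0$ with $\sum_{i\in I_\rho(x)}\lambda_i\|\nabla g_i(x)\|\le\beta\|\sum_{i\in I_\rho(x)}\lambda_i\nabla g_i(x)\|$ for all $x\in C$, $\lambda_i\ge0$, where $I_\rho(x)=\{i:g_i(x)\le\rho\}$. * (H3) The $\nu_i$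 are $C^1$ and Lipschitz with constant $L_\nu>0$, $\|\nabla\nu_i\|\le L_\nu$; and if $u\in U$, $v_i\in N_{U_i}(u)$, $\sum_iv_i=0$, then all $v_i=0$. * (H4) $A$ is nonempty and compact, and $f(x,A)$ is convex for each $x$. * (H5) $\varphi$ and $\ell$ are lower semicontinuous, $\ell$ is bounded from below on bounded sets, and $t\mapsto\ell(t,x(t),u(t),a(t),\dot x(t),\dot u(t))$ is summable on $[0,T]$ for each feasible quadruple. * (H6) $\Xi_x\times\Xi_T$ is closed around $(\bar x(\bar T),\bar T)$, i.e. its intersection with some closed neighbourhood of this point is closed. * (BV) For some $\mu>0$, $\dot{\bar x},\dot{\bar u},\bar a$ (suitable versions) have variation at most $\mu$ on $[0,\bar T]$, and for all $k\ge1$, with $h=\bar T/k$, $\|\frac{\bar u(h)-\bar u(0)}{h}\|\le\mu$ and $\|\frac{\bar u(\bar T)-\bar u(\bar T-h)}{h}\|\le\mu$. **Discrete problems.** Put $\bar h_k=\bar T/k$, $\delta_k=e^{L_f\bar T}(2L_f+1)(\bar h_k\mu+\bar T2^{-k})$, $\mu_k^x=(\bar h_k\mu+\bar T2^{-k})(2L_f+1)[e^{L_f\bar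 T}(1+L_f\bar h_k)+1]$, $\tilde\mu=\max\{3\mu+1+4L_f\bar T\mu e^{L_f\bar T}(2L_f+1)+2L_f\mu,\ 2e^{L_f\bar T}(2L_f+1)(\mu+1)+\mu\}$. Extend $\bar x,\bar u,\bar a$ beyond $\bar T$ by their values at $\bar T$ (and $\dot{\bar x},\dot{\bar u}$ by $0$). For $\varepsilon>0$ and $k\ge1$, problem $(P_k)$ is: over $(x_0,\dots,x_k,u_0,\dots,u_k,a_0,\dots,a_{k-1},T)$ with $T>0$, $h=T/k$, $t_j=jh$, $X_j=\frac{x_{j+1}-x_j}{h}$, $W_j=\frac{u_{j+1}-u_j}{h}$, minimize $$\varphi(x_k,T)+\sum_{j<k}h\,\ell(t_j,x_j,u_j,a_j,X_j,W_j)+\tfrac12(T-\bar T)^2+\tfrac12\sum_{j<k}\int_{t_j}^{t_{j+1}}\|(a_j,X_j,W_j)-(\bar a,\dot{\bar x},\dot{\bar u})(t)\|^2dt+\mathrm{dist}^2(\|W_0\|;(-\infty,\tilde\mu])+\mathrm{dist}^2\Big(\sum_{j=1}^{k-1}\Big\|\tfrac{u_{j+1}-2u_j+u_{j-1}}{h}\Big\|;(-\infty,\tilde\mu]\Big)$$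 subject to: $x_{j+1}\in x_j-hF(x_j,u_j,a_j)$, $\nu_i(u_j)\le L_\nu\delta_k$ for all $i$, $a_j\in A$ $(0\le j<k)$; $(x_0,u_0)=(x_0,\bar u(0))$ (the first component of the discrete trajectory is the given initial state); $x_k\in\Xi_x+\mu_k^xB$ and $T\in\Xi_T+[-\mu_k^x,\mu_k^x]$ ($B$ the closed unit ball); $|T-\bar T|\le\varepsilon$; $\sum_{j<k}\int_{t_j}^{t_{j+1}}\|(x_j,u_j,a_j)-(\bar x,\bar u,\bar a)(t)\|^2dt\le\frac\varepsilon2$; $\sum_{j<k}\int_{t_j}^{t_{j+1}}\|(X_j,W_j)-(\dot{\bar x},\dot{\bar u})(t)\|^2dt\le\frac\varepsilon2$; $\max\{\|W_0\|,\|W_{k-1}\|\}\le\tilde\mu+1$ and $\sum_{j=1}^{k-1}\|\frac{u_{j+1}-2u_j+u_{j-1}}{h}\|\le\tilde\mu+1$. **Claim.** There is $\varepsilon_0>0$ such that for every $\varepsilon\in(0,\varepsilon_0]$ problem $(P_k)$ has an optimal solution for all sufficiently large $k$. If $\Xi_x$ and $\Xi_T$ are closed, this holds for every $\varepsilon\in(0,\bar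 T)$. -/

import Mathlib

open Set Filter Topology MeasureTheory
open scoped Pointwise ENNReal

noncomputable section

namespace FreeSweeping

/-- Euclidean space `ℝⁿ`. -/
abbrev Vec (n : ℕ) : Type := EuclideanSpace ℝ (Fin n)

/-! ### Normal cones -/

/-- The Euclidean projector `Π(x; Ω)`. -/
def projector {n : ℕ} (Ω : Set (Vec n)) (x : Vec n) : Set (Vec n) :=
  {w | w ∈ Ω ∧ dist x w = Metric.infDist x Ω}

/-- The limiting (Mordukhovich) normal cone `N_Ω(x)`, empty if `x ∉ Ω`. -/
def normalCone {n : ℕ} (Ω : Set (Vec n)) (x : Vec n) : Set (Vec n) :=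
  {v | x ∈ Ω ∧ ∃ (y w : ℕ → Vec n) (α : ℕ → ℝ),
    Tendsto y atTop (𝓝 x) ∧ (∀ i, w i ∈ projector Ω (y i)) ∧ (∀ i, 0 ≤ α i) ∧
    Tendsto (fun i => α i • (y i - w i)) atTop (𝓝 v)}

/-! ### The data of the control problem -/

/-- The data of the free-time sweeping optimal control problem. The terminal cost `φ` is used at
points `(x, T)` with `T ≥ 0`, and the running cost `ℓ` at points `(t, x, u, a, ẋ, u̇)` with
`t ≥ 0`. -/
structure Data (n d m s : ℕ) where
  /-- perturbation of the dynamics -/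
  f : Vec n → Vec d → Vec n
  /-- functions defining the constraint set -/
  g : Fin m → Vec n → ℝ
  /-- functions defining the constraint on the control `u` -/
  ν : Fin s → Vec n → ℝ
  /-- control set for `a` -/
  A : Set (Vec d)
  /-- initial state -/
  x₀ : Vec n
  /-- endpoint constraint set for the state -/
  Ξx : Set (Vec n)
  /-- constraint set for the final time -/
  ΞT : Set ℝ
  /-- terminal cost -/
  φ : Vec n × ℝ → EReal
  /-- running cost -/
  ℓ : ℝ × Vec n × Vec n × Vec d × Vec n × Vec n → EReal

namespace Data

variable {n d m s : ℕ} (D : Data n d m s)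

/-- `C_i = {x | g_i(x) ≥ 0}`. -/
def Ci (i : Fin m) : Set (Vec n) := {x | 0 ≤ D.g i x}

/-- `C = ⋂ C_i`; the moving set is `C_u = C + u`. -/
def C : Set (Vec n) := ⋂ i, D.Ci i

/-- `U_i = {u | ν_i(u) ≤ 0}`. -/
def Ui (i : Fin s) : Set (Vec n) := {u | D.ν i u ≤ 0}

/-- `U = ⋂ U_i`. -/
def U : Set (Vec n) := ⋂ i, D.Ui i

/-- The velocity mapping `F(x, u, a) = N_C(x - u) - f(x, a)`. -/
def F (x u : Vec n) (a : Vec d) : Set (Vec n) :=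
  {w | ∃ v ∈ normalCone D.C (x - u), w = v - D.f x a}

end Data

/-! ### Processes in continuous time -/

/-- `x ∈ W^{1,2}([0,T]; ℝⁿ)` and `v` is a version of its derivative. -/
def IsW12 {n : ℕ} (T : ℝ) (x v : ℝ → Vec n) : Prop :=
  MemLp v 2 (volume.restrict (Icc 0 T)) ∧ ∀ t ∈ Icc 0 T, x t = x 0 + ∫ s in (0 : ℝ)..t, v s

/-- A quadruple `(x, u, a, T)` together with versions `vx`, `vu` of `ẋ`, `u̇`. Only the values of
the functions on `[0, T]` matter. -/
structure ControlProcess (n d : ℕ) where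
  x : ℝ → Vec n
  vx : ℝ → Vec n
  u : ℝ → Vec n
  vu : ℝ → Vec n
  a : ℝ → Vec d
  T : ℝ

/-- Feasibility in the free-time sweeping control problem. -/
structure IsFeasible {n d m s : ℕ} (D : Data n d m s) (p : ControlProcess n d) : Prop where
  time_nonneg : 0 ≤ p.T
  state : IsW12 p.T p.x p.vx
  control_u : IsW12 p.T p.u p.vu
  control_a : MemLp p.a 2 (volume.restrict (Icc 0 p.T))
  u_mem : ∀ᵐ t ∂(volume.restrict (Icc 0 p.T)), p.u t ∈ D.U
  a_mem : ∀ᵐ t ∂(volume.restrict (Icc 0 p.T)), p.a t ∈ D.A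
  dynamics : ∀ᵐ t ∂(volume.restrict (Icc 0 p.T)), -(p.vx t) ∈ D.F (p.x t) (p.u t) (p.a t)
  initial : p.x 0 = D.x₀
  initial_mem : D.x₀ - p.u 0 ∈ D.C
  endpoint : p.x p.T ∈ D.Ξx
  endtime : p.T ∈ D.ΞT

namespace ControlProcess

variable {n d : ℕ} (p : ControlProcess n d)

/-- Extension of the trajectory by its final value. -/
def xe (t : ℝ) : Vec n := p.x (min t p.T)

/-- Extension of the control `u` by its final value. -/
def ue (t : ℝ) : Vec n := p.u (min t p.T)

/-- Extension of the control `a` by its final value. -/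
def ae (t : ℝ) : Vec d := p.a (min t p.T)

/-- Derivative of the extended trajectory. -/
def vxe (t : ℝ) : Vec n := if t ≤ p.T then p.vx t else 0

/-- Derivative of the extended control `u`. -/
def vue (t : ℝ) : Vec n := if t ≤ p.T then p.vu t else 0

end ControlProcess

/-- `ẋ`, `u̇`, `a` have variation at most `μ` on `[0, T]`, and the first and last difference
quotients of `u` on each uniform mesh `t_j = j T / k` have norm at most `μ`. -/
structure BVBound {n d : ℕ} (p : ControlProcess n d) (μ : ℝ) : Prop where
  var_vx : eVariationOn p.vx (Icc 0 p.T) ≤ ENNReal.ofReal μ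
  var_vu : eVariationOn p.vu (Icc 0 p.T) ≤ ENNReal.ofReal μ
  var_a : eVariationOn p.a (Icc 0 p.T) ≤ ENNReal.ofReal μ
  first_quot : ∀ k : ℕ, 1 ≤ k → ‖(p.T / k)⁻¹ • (p.u (p.T / k) - p.u 0)‖ ≤ μ
  last_quot : ∀ k : ℕ, 1 ≤ k → ‖(p.T / k)⁻¹ • (p.u p.T - p.u (p.T - p.T / k))‖ ≤ μ

/-! ### Assumptions -/

namespace Data

variable {n d m s : ℕ} (D : Data n d m s)

/-- `f` is globally Lipschitz with constant `Lf`, and has linear growth on the moving sets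
`C_{u(t)} = C + u(t)`, `t ∈ [0, T]`. -/
structure PerturbationAssumption (Lf : ℝ) (u : ℝ → Vec n) (T : ℝ) : Prop where
  pos : 0 < Lf
  lipschitz : ∀ x₁ x₂ a₁ a₂, ‖D.f x₁ a₁ - D.f x₂ a₂‖ ≤ Lf * (‖x₁ - x₂‖ + ‖a₁ - a₂‖)
  growth : ∃ M : ℝ, 0 < M ∧ ∀ t ∈ Icc 0 T, ∀ x, x - u t ∈ D.C → ∀ a,
    ‖D.f x a‖ ≤ M * (1 + ‖x‖)

open Classical in
/-- Regularity of the functions `g_i` defining the moving set. -/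
structure ConstraintAssumption : Prop where
  convex : ∀ i, ConvexOn ℝ univ (D.g i)
  smooth : ∀ i, ContDiff ℝ 2 (D.g i)
  gradient_bounds : ∃ (c M₁ M₂ M₃ : ℝ) (V : Fin m → Set (Vec n)),
    0 < c ∧ 0 < M₁ ∧ 0 < M₂ ∧ 0 < M₃ ∧
    ∀ i, IsOpen (V i) ∧ D.Ci i ⊆ V i ∧
      ENNReal.ofReal c < Metric.hausdorffEDist (D.Ci i) (V i)ᶜ ∧
      ∀ x ∈ V i, M₁ ≤ ‖gradient (D.g i) x‖ ∧ ‖gradient (D.g i) x‖ ≤ M₂ ∧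
        ‖fderiv ℝ (gradient (D.g i)) x‖ ≤ M₃
  inverse_triangle : ∃ β ρ : ℝ, 0 < β ∧ 0 < ρ ∧
    ∀ x ∈ D.C, ∀ lam : Fin m → ℝ, (∀ i, 0 ≤ lam i) →
      ∑ i ∈ Finset.univ.filter (fun i => D.g i x ≤ ρ), lam i * ‖gradient (D.g i) x‖ ≤
        β * ‖∑ i ∈ Finset.univ.filter (fun i => D.g i x ≤ ρ), lam i • gradient (D.g i) x‖

/-- Assumptions on the functions `ν_i` defining the constraint `u(t) ∈ U`. -/
structure ControlConstraintAssumption (Lν : ℝ) : Prop where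
  pos : 0 < Lν
  smooth : ∀ i, ContDiff ℝ 1 (D.ν i)
  lipschitz : ∀ i u₁ u₂, |D.ν i u₂ - D.ν i u₁| ≤ Lν * ‖u₂ - u₁‖
  gradient_bound : ∀ i u, ‖gradient (D.ν i) u‖ ≤ Lν
  qualification : ∀ u ∈ D.U, ∀ v : Fin s → Vec n, (∀ i, v i ∈ normalCone (D.Ui i) u) →
    ∑ i, v i = 0 → ∀ i, v i = 0

/-- Assumptions on the control set `A`. -/
structure ControlSetAssumption : Prop where
  nonempty : D.A.Nonempty
  compact : IsCompact D.A
  convex : ∀ x, Convex ℝ (D.f x '' D.A)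

/-- Assumptions on the costs: they take values in `(-∞, ∞]` and are lower semicontinuous,
the running cost is bounded from below on bounded sets, and it is summable along
each feasible process. -/
structure CostAssumption : Prop where
  terminal_ne_bot : ∀ z, D.φ z ≠ ⊥
  terminal_lsc : LowerSemicontinuousOn D.φ (univ ×ˢ Ici 0)
  running_ne_bot : ∀ z, D.ℓ z ≠ ⊥
  running_lsc : LowerSemicontinuousOn D.ℓ (Ici 0 ×ˢ univ)
  running_bddBelow : ∀ (T : ℝ) (S : Set (Vec n × Vec n × Vec d × Vec n × Vec n)),
    Bornology.IsBounded S → ∃ c : ℝ, ∀ t ∈ Icc 0 T, ∀ z ∈ S, (c : EReal) ≤ D.ℓ (t, z)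
  summable : ∀ p : ControlProcess n d, IsFeasible D p →
    (∀ᵐ t ∂(volume.restrict (Icc 0 p.T)),
      D.ℓ (t, p.x t, p.u t, p.a t, p.vx t, p.vu t) ≠ ⊤) ∧
    IntegrableOn (fun t => (D.ℓ (t, p.x t, p.u t, p.a t, p.vx t, p.vu t)).toReal) (Icc 0 p.T)

end Data

/-- The set `S` is closed around the point `z`: its intersection with some closed neighbourhood
of `z` is closed. -/
def ClosedAround {α : Type*} [TopologicalSpace α] (S : Set α) (z : α) : Prop :=
  ∃ V ∈ 𝓝 z, IsClosed V ∧ IsClosed (S ∩ V)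

/-! ### The discrete problems -/

/-- `δ_k` for the reference final time `T`. -/
def delta (Lf μ T : ℝ) (k : ℕ) : ℝ :=
  Real.exp (Lf * T) * (2 * Lf + 1) * (T / k * μ + T * 2⁻¹ ^ k)

/-- `μ^x_k` for the reference final time `T`. -/
def muX (Lf μ T : ℝ) (k : ℕ) : ℝ :=
  (T / k * μ + T * 2⁻¹ ^ k) * (2 * Lf + 1) * (Real.exp (Lf * T) * (1 + Lf * (T / k)) + 1)

/-- The constant `μ̃` for the reference final time `T`. -/
def muTilde (Lf μ T : ℝ) : ℝ :=
  max (3 * μ + 1 + 4 * Lf * T * μ * Real.exp (Lf * T) * (2 * Lf + 1) + 2 * Lf * μ)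
    (2 * Real.exp (Lf * T) * (2 * Lf + 1) * (μ + 1) + μ)

/-- The variables `(x_0, …, x_k, u_0, …, u_k, a_0, …, a_{k-1}, T)` of the `k`-th problem. -/
structure DiscreteProcess (n d k : ℕ) where
  x : Fin (k + 1) → Vec n
  u : Fin (k + 1) → Vec n
  a : Fin k → Vec d
  T : ℝ

namespace DiscreteProcess

variable {n d k : ℕ} (z : DiscreteProcess n d k)

/-- The step size `h = T / k`. -/
def h : ℝ := z.T / k

/-- The mesh point `t_j = j h`. -/
def t (j : ℕ) : ℝ := j * z.h

/-- The difference quotient `(x_{j+1} - x_j) / h`. -/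
def dx (j : Fin k) : Vec n := z.h⁻¹ • (z.x j.succ - z.x j.castSucc)

/-- The difference quotient `(u_{j+1} - u_j) / h`. -/
def du (j : Fin k) : Vec n := z.h⁻¹ • (z.u j.succ - z.u j.castSucc)

/-- `u_j` for a natural number `j ≤ k`. -/
def uAt (j : ℕ) : Vec n := z.u (Fin.ofNat (k + 1) j)

/-- `‖(u_1 - u_0) / h‖`. -/
def firstQuot : ℝ := ‖z.h⁻¹ • (z.uAt 1 - z.uAt 0)‖

/-- `‖(u_k - u_{k-1}) / h‖`. -/
def lastQuot : ℝ := ‖z.h⁻¹ • (z.uAt k - z.uAt (k - 1))‖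

/-- `∑_{j=1}^{k-1} ‖(u_{j+1} - 2 u_j + u_{j-1}) / h‖`. -/
def secondVar : ℝ :=
  ∑ j ∈ Finset.Ico 1 k, ‖z.h⁻¹ • (z.uAt (j + 1) - (2 : ℝ) • z.uAt j + z.uAt (j - 1))‖

/-- The cost functional of the `k`-th discrete problem around the reference process `p`. -/
def cost {m s : ℕ} (D : Data n d m s) (p : ControlProcess n d) (Lf μ : ℝ) : EReal :=
  D.φ (z.x (Fin.last k), z.T)
  + ∑ j : Fin k, (z.h : EReal) *
      D.ℓ (z.t j, z.x j.castSucc, z.u j.castSucc, z.a j, z.dx j, z.du j)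
  + ((1 / 2 * (z.T - p.T) ^ 2
      + 1 / 2 * ∑ j : Fin k, ∫ τ in (z.t j)..(z.t (j + 1)),
          (‖z.a j - p.ae τ‖ ^ 2 + ‖z.dx j - p.vxe τ‖ ^ 2 + ‖z.du j - p.vue τ‖ ^ 2)
      + Metric.infDist z.firstQuot (Iic (muTilde Lf μ p.T)) ^ 2
      + Metric.infDist z.secondVar (Iic (muTilde Lf μ p.T)) ^ 2 : ℝ) : EReal)

/-- The constraints of the `k`-th discrete problem around the reference process `p`. -/
structure Feasible {m s : ℕ} (D : Data n d m s) (p : ControlProcess n d) (Lf Lν μ ε : ℝ) : Prop where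
  /-- the mesh `0 = t_0 < t_1 < … < t_k = T` is nondegenerate -/
  time_pos : 0 < z.T
  /-- `x_{j+1} ∈ x_j - h F(x_j, u_j, a_j)` -/
  dynamics : ∀ j : Fin k, ∃ w ∈ D.F (z.x j.castSucc) (z.u j.castSucc) (z.a j),
    z.x j.succ = z.x j.castSucc - z.h • w
  initial_x : z.x 0 = D.x₀
  initial_u : z.u 0 = p.u 0
  endpoint : z.x (Fin.last k) ∈ D.Ξx + Metric.closedBall 0 (muX Lf μ p.T k)
  endtime : z.T ∈ D.ΞT + Metric.closedBall 0 (muX Lf μ p.T k)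
  time_local : |z.T - p.T| ≤ ε
  u_mem : ∀ (j : Fin k) (i : Fin s), D.ν i (z.u j.castSucc) ≤ Lν * delta Lf μ p.T k
  a_mem : ∀ j : Fin k, z.a j ∈ D.A
  local_values : ∑ j : Fin k, ∫ τ in (z.t j)..(z.t (j + 1)),
    (‖z.x j.castSucc - p.xe τ‖ ^ 2 + ‖z.u j.castSucc - p.ue τ‖ ^ 2 + ‖z.a j - p.ae τ‖ ^ 2)
      ≤ ε / 2
  local_velocities : ∑ j : Fin k, ∫ τ in (z.t j)..(z.t (j + 1)),
    (‖z.dx j - p.vxe τ‖ ^ 2 + ‖z.du j - p.vue τ‖ ^ 2) ≤ ε / 2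
  end_quots : max z.firstQuot z.lastQuot ≤ muTilde Lf μ p.T + 1
  second_var : z.secondVar ≤ muTilde Lf μ p.T + 1

end DiscreteProcess

/-- The `k`-th discrete problem around the reference process `p` has an optimal solution. -/
def HasOptimalSolution {n d m s : ℕ} (D : Data n d m s) (p : ControlProcess n d)
    (Lf Lν μ ε : ℝ) (k : ℕ) : Prop :=
  ∃ z : DiscreteProcess n d k, z.Feasible D p Lf Lν μ ε ∧
    ∀ z' : DiscreteProcess n d k, z'.Feasible D p Lf Lν μ ε →
      z.cost D p Lf μ ≤ z'.cost D p Lf μ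

end FreeSweeping

end

noncomputable section

namespace FreeSweeping

/-! The existence proof is the direct method in a finite-dimensional space, plus the explicit
construction of one feasible point.

Compactness. The discrete path starts at a fixed point, and its slopes are constrained to be close
in L² to the reference velocity, so all nodes lie in a fixed ball; `A` is compact and `T` ranges
over a compact interval. The constraints pass to limits because the limiting normal cone to the
closed set `C` has closed graph and because `ε < p.T` keeps the step size away from zero. The cost
is lower semicontinuous there, since no term equals `⊥` and every step weight is positive. When the
endpoint sets are closed only near the reference endpoint, feasible endpoints are forced into that
neighbourhood by taking `ε` small and `k` large.

Feasibility. Bounded variation gives right limits `V j`, `a j` of the state velocity and of `a` at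
the mesh points, and the closed graph turns the almost-everywhere inclusion into one valid at each
mesh point. An Euler scheme with slopes `V j`, corrected by the change of `f`, defines the new
states; the control `u` is shifted by the same error `e j` as the state. The difference state minus
control is then unchanged at the nodes, so the same normal vector serves. Discrete Gronwall bounds
`e j` by a multiple of the step, because the local errors are bounded by cell variations, whose sum
is at most `μ`. The remaining constraints follow with `T = p.T`. -/

section

/-! ### Closed graph of the normal cone -/

/-- The graph of the limiting normal cone to a closed set is closed. -/
theorem isClosed_graph_normalCone {n : ℕ} {Ω : Set (Vec n)} (hΩ : IsClosed Ω) :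
    IsClosed {q : Vec n × Vec n | q.2 ∈ normalCone Ω q.1} := by
  refine isSeqClosed_iff_isClosed.1 ?_
  intro q z hq hz
  have hz1 : Tendsto (fun i => (q i).1) atTop (𝓝 z.1) := (continuous_fst.tendsto z).comp hz
  have hz2 : Tendsto (fun i => (q i).2) atTop (𝓝 z.2) := (continuous_snd.tendsto z).comp hz
  -- Diagonal choice: from the sequence representing the `i`-th normal vector, one term within
  -- `1/(i+1)` of both its base point and the vector.
  have key : ∀ i : ℕ, ∃ (y w : Vec n) (α : ℝ), dist y (q i).1 < 1 / ((i : ℝ) + 1) ∧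
      w ∈ projector Ω y ∧ 0 ≤ α ∧ dist (α • (y - w)) (q i).2 < 1 / ((i : ℝ) + 1) := by
    intro i
    obtain ⟨-, y, w, α, hy, hw, hα, hv⟩ := hq i
    have hpos : (0 : ℝ) < 1 / ((i : ℝ) + 1) := by positivity
    obtain ⟨l, hl1, hl2⟩ := ((Metric.tendsto_nhds.1 hy _ hpos).and
      (Metric.tendsto_nhds.1 hv _ hpos)).exists
    exact ⟨y l, w l, α l, hl1, hw l, hα l, hl2⟩
  choose y w α hy hw hα hv using key
  refine ⟨hΩ.mem_of_tendsto hz1 (Eventually.of_forall fun i => (hq i).1), y, w, α, ?_, hw, hα, ?_⟩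
  · refine (tendsto_iff_of_dist ?_).2 hz1
    exact squeeze_zero (fun _ => dist_nonneg) (fun i => (hy i).le)
      tendsto_one_div_add_atTop_nhds_zero_nat
  · refine (tendsto_iff_of_dist ?_).2 hz2
    exact squeeze_zero (fun _ => dist_nonneg) (fun i => (hv i).le)
      tendsto_one_div_add_atTop_nhds_zero_nat

/-! ### Integrals of bounded measurable functions on the half-line -/

/-- `q` is bounded and almost everywhere measurable on `[0, ∞)`. -/
structure Tame {E : Type*} [NormedAddCommGroup E] (q : ℝ → E) (K : ℝ) : Prop where
  meas : AEStronglyMeasurable q (volume.restrict (Ici 0))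
  bound : ∀ t, 0 ≤ t → ‖q t‖ ≤ K

namespace Tame

variable {E : Type*} [NormedAddCommGroup E] {q : ℝ → E} {K : ℝ}

theorem const (c : E) : Tame (fun _ => c) ‖c‖ :=
  ⟨aestronglyMeasurable_const, fun _ _ => le_rfl⟩

theorem sub {r : ℝ → E} {K' : ℝ} (hq : Tame q K) (hr : Tame r K') :
    Tame (fun t => q t - r t) (K + K') :=
  ⟨hq.meas.sub hr.meas, fun t ht =>
    (norm_sub_le _ _).trans (add_le_add (hq.bound t ht) (hr.bound t ht))⟩

theorem norm_sq (hq : Tame q K) : Tame (fun t => ‖q t‖ ^ 2) (K ^ 2) :=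
  ⟨hq.meas.norm.pow 2, fun t ht => by
    rw [norm_pow, norm_norm]; exact pow_le_pow_left₀ (norm_nonneg _) (hq.bound t ht) 2⟩

theorem intervalIntegrable (hq : Tame q K) {a b : ℝ} (ha : 0 ≤ a) (hb : 0 ≤ b) :
    IntervalIntegrable q volume a b := by
  have hsub : uIoc a b ⊆ Ici 0 := fun t ht => (le_min ha hb).trans ht.1.le
  rw [intervalIntegrable_iff]
  refine Integrable.mono' (g := fun _ => K) ?_ (hq.meas.mono_set hsub) ?_
  · exact integrableOn_const (by simp [uIoc])
  · exact (ae_restrict_mem measurableSet_uIoc).mono fun t ht => hq.bound t (hsub ht)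

/-- A function that is bounded and measurable on `[0, T]`, and constant beyond `T`. -/
theorem of_Icc {T : ℝ} {r : ℝ → E} {c : E} (hm : AEStronglyMeasurable r (volume.restrict (Icc 0 T)))
    (hb : ∀ t ∈ Icc 0 T, ‖r t‖ ≤ K) (hc : ‖c‖ ≤ K) (h1 : ∀ t ∈ Icc 0 T, q t = r t)
    (h2 : ∀ t, T < t → q t = c) : Tame q K := by
  constructor
  · have hsub : Ici (0 : ℝ) ⊆ Icc 0 T ∪ Ioi T := fun t ht => by
      rcases le_or_gt t T with h | h
      · exact Or.inl ⟨ht, h⟩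
      · exact Or.inr h
    refine AEStronglyMeasurable.mono_set hsub ?_
    rw [aestronglyMeasurable_union_iff]
    constructor
    · exact hm.congr ((ae_restrict_mem measurableSet_Icc).mono fun t ht => (h1 t ht).symm)
    · exact (aestronglyMeasurable_const (b := c)).congr
        ((ae_restrict_mem measurableSet_Ioi).mono fun t ht => (h2 t ht).symm)
  · intro t ht
    rcases le_or_gt t T with h | h
    · rw [h1 t ⟨ht, h⟩]; exact hb t ⟨ht, h⟩
    · rw [h2 t h]; exact hc

section

variable [NormedSpace ℝ E] {X : Type*} [TopologicalSpace X]

/-- Integrals of a tame function depend continuously on the end points. -/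
theorem continuousAt_integral (hq : Tame q K) {a b : X → ℝ} {z : X} (ha : ContinuousAt a z)
    (hb : ContinuousAt b z) (ha0 : ∀ᶠ y in 𝓝 z, 0 ≤ a y) (hb0 : ∀ᶠ y in 𝓝 z, 0 ≤ b y) :
    ContinuousAt (fun y => ∫ τ in (a y)..(b y), q τ) z := by
  -- Extension by zero makes the primitive continuous on all of `ℝ`; nonnegative end points do not
  -- see the change.
  set r : ℝ → E := (Ici (0 : ℝ)).indicator q with hr
  have hrt : ∀ t, ‖r t‖ ≤ max K 0 := fun t => by
    by_cases ht : t ∈ Ici (0 : ℝ)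
    · simp only [hr, indicator_of_mem ht]; exact (hq.bound t ht).trans (le_max_left _ _)
    · simp [hr, indicator_of_notMem ht]
  have hrm : AEStronglyMeasurable r volume :=
    (aestronglyMeasurable_indicator_iff measurableSet_Ici).2 hq.meas
  have hri : ∀ a b, IntervalIntegrable r volume a b := fun a b => by
    rw [intervalIntegrable_iff]
    exact Integrable.mono' (g := fun _ => max K 0) (integrableOn_const (by simp [uIoc]))
      hrm.restrict (Eventually.of_forall hrt)
  have hcont := intervalIntegral.continuous_primitive hri 0
  have hev : (fun y => ∫ τ in (a y)..(b y), q τ) =ᶠ[𝓝 z]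
      fun y => (∫ τ in (0 : ℝ)..(b y), r τ) - ∫ τ in (0 : ℝ)..(a y), r τ := by
    filter_upwards [ha0, hb0] with y hay hby
    rw [intervalIntegral.integral_interval_sub_left (hri _ _) (hri _ _)]
    refine intervalIntegral.integral_congr fun t ht => ?_
    have ht0 : t ∈ Ici (0 : ℝ) := (le_min hay hby).trans ht.1
    simp [hr, indicator_of_mem ht0]
  refine ContinuousAt.congr ?_ hev.symm
  exact (hcont.continuousAt.comp hb).sub (hcont.continuousAt.comp ha)

end

theorem intervalIntegrable_sq (hq : Tame q K) (c : E) {a b : ℝ} (ha : 0 ≤ a) (hb : 0 ≤ b) :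
    IntervalIntegrable (fun τ => ‖c - q τ‖ ^ 2) volume a b :=
  ((Tame.const c).sub hq).norm_sq.intervalIntegrable ha hb

/-- Integrals of `‖c - q‖²` depend continuously on `c` and the end points. -/
theorem continuousAt_integral_sq [InnerProductSpace ℝ E] [CompleteSpace E]
    {X : Type*} [TopologicalSpace X]
    (hq : Tame q K) {a b : X → ℝ} {c : X → E} {z : X} (hc : ContinuousAt c z)
    (ha : ContinuousAt a z)
    (hb : ContinuousAt b z) (ha0 : ∀ᶠ y in 𝓝 z, 0 ≤ a y) (hb0 : ∀ᶠ y in 𝓝 z, 0 ≤ b y) :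
    ContinuousAt (fun y => ∫ τ in (a y)..(b y), ‖c y - q τ‖ ^ 2) z := by
  -- Expanding the square takes `c y` out of the integral; what remains are integrals of the fixed
  -- functions `q` and `‖q‖²`.
  have hev : (fun y => ∫ τ in (a y)..(b y), ‖c y - q τ‖ ^ 2) =ᶠ[𝓝 z]
      fun y => (b y - a y) * ‖c y‖ ^ 2 - 2 * inner ℝ (c y) (∫ τ in (a y)..(b y), q τ)
        + ∫ τ in (a y)..(b y), ‖q τ‖ ^ 2 := by
    filter_upwards [ha0, hb0] with y hay hby
    have hi := hq.intervalIntegrable hay hby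
    have hin : IntervalIntegrable (fun τ => inner ℝ (c y) (q τ)) volume (a y) (b y) :=
      ⟨(innerSL ℝ (c y)).integrable_comp hi.1, (innerSL ℝ (c y)).integrable_comp hi.2⟩
    have hint : ∫ τ in (a y)..(b y), inner ℝ (c y) (q τ)
        = inner ℝ (c y) (∫ τ in (a y)..(b y), q τ) :=
      (innerSL ℝ (c y)).intervalIntegral_comp_comm hi
    simp_rw [norm_sub_sq_real]
    rw [intervalIntegral.integral_add, intervalIntegral.integral_sub,
      intervalIntegral.integral_const, intervalIntegral.integral_const_mul, hint, smul_eq_mul]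
    · exact intervalIntegrable_const
    · exact hin.const_mul 2
    · exact intervalIntegrable_const.sub (hin.const_mul 2)
    · exact hq.norm_sq.intervalIntegrable hay hby
  refine ContinuousAt.congr ?_ hev.symm
  refine ((hb.sub ha).mul (hc.norm.pow 2)).sub ?_ |>.add
    (hq.norm_sq.continuousAt_integral ha hb ha0 hb0)
  exact continuousAt_const.mul (hc.inner (𝕜 := ℝ) (hq.continuousAt_integral ha hb ha0 hb0))

/-- A polygonal path whose slopes are close in `L²` to `q` stays close to a primitive of `q`. -/
theorem dist_polygon_le [NormedSpace ℝ E] [CompleteSpace E] (hq : Tame q K) {y : ℝ → E}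
    (hy : ∀ a b, 0 ≤ a → a ≤ b → y b - y a = ∫ τ in a..b, q τ) {h lam : ℝ} (hh : 0 < h)
    (hlam : 0 < lam) (X : ℕ → E) (hX : X 0 = y 0) (k : ℕ) :
    ‖X k - y (k * h)‖ ≤ lam * (k * h) + lam⁻¹ * ∑ i ∈ Finset.range k,
      ∫ τ in (i * h)..((i + 1 : ℕ) * h), ‖h⁻¹ • (X (i + 1) - X i) - q τ‖ ^ 2 := by
  induction k with
  | zero => simp [hX]
  | succ j ih =>
    have ha : (0 : ℝ) ≤ j * h := by positivity
    have hb : (0 : ℝ) ≤ (j + 1 : ℕ) * h := by positivity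
    have hab : (j : ℝ) * h ≤ (j + 1 : ℕ) * h := by push_cast; nlinarith
    set w := h⁻¹ • (X (j + 1) - X j) with hw
    have hst : X (j + 1) - y ((j + 1 : ℕ) * h)
        = (X j - y (j * h)) + ∫ τ in (j * h)..((j + 1 : ℕ) * h), (w - q τ) := by
      rw [intervalIntegral.integral_sub intervalIntegrable_const (hq.intervalIntegrable ha hb),
        intervalIntegral.integral_const, ← hy _ _ ha hab]
      have : ((j + 1 : ℕ) * h - j * h : ℝ) = h := by push_cast; ring
      rw [this, hw, smul_inv_smul₀ hh.ne']
      abel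
    -- Based on `s ≤ lam + lam⁻¹ * s ^ 2` for `s ≥ 0`, used in place of Cauchy–Schwarz. The
    -- parameter `lam` stays free, so the final bound can be made small.
    have hle : ‖∫ τ in (j * h)..((j + 1 : ℕ) * h), (w - q τ)‖ ≤
        ∫ τ in (j * h)..((j + 1 : ℕ) * h), (lam + lam⁻¹ * ‖w - q τ‖ ^ 2) := by
      refine intervalIntegral.norm_integral_le_of_norm_le hab (Eventually.of_forall fun τ _ => ?_) ?_
      · have h0 : 0 < lam⁻¹ := inv_pos.2 hlam
        have h1 : lam * lam⁻¹ = 1 := mul_inv_cancel₀ hlam.ne'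
        rcases le_or_gt ‖w - q τ‖ lam with hc | hc
        · have : 0 ≤ lam⁻¹ * ‖w - q τ‖ ^ 2 := by positivity
          linarith
        · have h2 : lam⁻¹ * ‖w - q τ‖ ≥ 1 := by
            rw [← h1, mul_comm]; gcongr
          nlinarith [norm_nonneg (w - q τ)]
      · exact intervalIntegrable_const.add ((hq.intervalIntegrable_sq w ha hb).const_mul _)
    rw [intervalIntegral.integral_add intervalIntegrable_const
      ((hq.intervalIntegrable_sq w ha hb).const_mul _), intervalIntegral.integral_const,
      intervalIntegral.integral_const_mul, smul_eq_mul] at hle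
    rw [hst, Finset.sum_range_succ]
    refine (norm_add_le _ _).trans ((add_le_add ih hle).trans (le_of_eq ?_))
    push_cast
    ring

end Tame

end

/-! ### Bounds on the extended reference process; extended real sums -/

section

theorem norm_sub_le_of_eVariationOn_le {E : Type*} [NormedAddCommGroup E] {q : ℝ → E} {S : Set ℝ}
    {c : ℝ} (hc : 0 ≤ c) (hq : eVariationOn q S ≤ ENNReal.ofReal c) {a b : ℝ} (ha : a ∈ S)
    (hb : b ∈ S) : ‖q a - q b‖ ≤ c := by
  have h := (eVariationOn.edist_le q ha hb).trans hq
  rw [edist_dist, ENNReal.ofReal_le_ofReal_iff hc, dist_eq_norm] at h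
  exact h

theorem norm_le_of_eVariationOn_le {E : Type*} [NormedAddCommGroup E] {q : ℝ → E} {T c : ℝ}
    (hT : 0 ≤ T) (hc : 0 ≤ c) (hq : eVariationOn q (Icc 0 T) ≤ ENNReal.ofReal c) {t : ℝ}
    (ht : t ∈ Icc 0 T) : ‖q t‖ ≤ ‖q 0‖ + c := by
  have h := norm_sub_le_of_eVariationOn_le hc hq ht (left_mem_Icc.2 hT)
  have h2 := norm_sub_norm_le (q t) (q 0)
  linarith

section Extension

variable {n : ℕ} {T K : ℝ} {x v : ℝ → Vec n}

theorem Tame.extend_derivative (hT : 0 ≤ T) (h : IsW12 T x v) (hv : ∀ t ∈ Icc 0 T, ‖v t‖ ≤ K) :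
    Tame (fun t => if t ≤ T then v t else 0) K := by
  have hK : 0 ≤ K := (norm_nonneg _).trans (hv 0 (left_mem_Icc.2 hT))
  exact Tame.of_Icc (c := 0) h.1.1 hv (by simpa using hK) (fun t ht => if_pos ht.2)
    (fun t ht => if_neg (not_le.2 ht))

theorem extend_eq_add_integral (hT : 0 ≤ T) (h : IsW12 T x v) (hv : ∀ t ∈ Icc 0 T, ‖v t‖ ≤ K)
    {t : ℝ} (ht : 0 ≤ t) :
    x (min t T) = x 0 + ∫ τ in (0 : ℝ)..t, if τ ≤ T then v τ else 0 := by
  have hq := Tame.extend_derivative hT h hv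
  have hsmall : ∀ t, 0 ≤ t → t ≤ T →
      x t = x 0 + ∫ τ in (0 : ℝ)..t, if τ ≤ T then v τ else 0 := fun t ht htT => by
    rw [h.2 t ⟨ht, htT⟩]
    congr 1
    refine intervalIntegral.integral_congr fun τ hτ => ?_
    rw [uIcc_of_le ht] at hτ
    exact (if_pos (hτ.2.trans htT)).symm
  rcases le_total t T with htT | htT
  · rw [min_eq_left htT, ← hsmall t ht htT]
  · rw [min_eq_right htT, hsmall T hT le_rfl]
    congr 1
    rw [← intervalIntegral.integral_add_adjacent_intervals
      (hq.intervalIntegrable le_rfl hT) (hq.intervalIntegrable hT ht)]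
    rw [intervalIntegral.integral_congr_ae (a := T) (b := t) (g := fun _ => (0 : Vec n))]
    · simp
    · refine Eventually.of_forall fun τ hτ => ?_
      rw [uIoc_of_le htT] at hτ
      exact if_neg (not_le.2 hτ.1)

theorem extend_sub_extend (hT : 0 ≤ T) (h : IsW12 T x v) (hv : ∀ t ∈ Icc 0 T, ‖v t‖ ≤ K)
    (a b : ℝ) (ha : 0 ≤ a) (hab : a ≤ b) :
    x (min b T) - x (min a T) = ∫ τ in a..b, if τ ≤ T then v τ else 0 := by
  have hq := Tame.extend_derivative hT h hv
  rw [extend_eq_add_integral hT h hv ha, extend_eq_add_integral hT h hv (ha.trans hab),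
    add_sub_add_left_eq_sub, intervalIntegral.integral_interval_sub_left
      (hq.intervalIntegrable le_rfl (ha.trans hab)) (hq.intervalIntegrable le_rfl ha)]

theorem norm_extend_sub_extend_le (hT : 0 ≤ T) (h : IsW12 T x v) (hv : ∀ t ∈ Icc 0 T, ‖v t‖ ≤ K)
    {a b : ℝ} (ha : 0 ≤ a) (hb : 0 ≤ b) : ‖x (min b T) - x (min a T)‖ ≤ K * |b - a| := by
  have hq := Tame.extend_derivative hT h hv
  wlog hab : a ≤ b generalizing a b
  · rw [norm_sub_rev, abs_sub_comm]
    exact this hb ha (le_of_not_ge hab)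
  rw [extend_sub_extend hT h hv a b ha hab]
  refine intervalIntegral.norm_integral_le_of_norm_le_const fun τ hτ => ?_
  rw [uIoc_of_le hab] at hτ
  exact hq.bound τ (ha.trans hτ.1.le)

theorem Tame.extend (hT : 0 ≤ T) (h : IsW12 T x v) (hv : ∀ t ∈ Icc 0 T, ‖v t‖ ≤ K) :
    Tame (fun t => x (min t T)) (‖x 0‖ + K * T) := by
  have hK : 0 ≤ K := (norm_nonneg _).trans (hv 0 (left_mem_Icc.2 hT))
  constructor
  · refine ContinuousOn.aestronglyMeasurable ?_ measurableSet_Ici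
    refine (LipschitzOnWith.of_dist_le_mul (K := ⟨K, hK⟩) fun b hb a ha => ?_).continuousOn
    rw [dist_eq_norm, Real.dist_eq]
    exact norm_extend_sub_extend_le hT h hv ha hb
  · intro t ht
    have h1 := norm_extend_sub_extend_le hT h hv le_rfl (le_min ht hT)
    rw [min_eq_left hT, sub_zero, abs_of_nonneg (le_min ht hT), min_assoc, min_self] at h1
    have h2 := norm_sub_norm_le (x (min t T)) (x 0)
    have h3 : K * min t T ≤ K * T := mul_le_mul_of_nonneg_left (min_le_right _ _) hK
    linarith

end Extension

/-- The extended reference process is bounded and measurable, with bounded velocities. -/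
structure TameReference {n d : ℕ} (p : ControlProcess n d) (K : ℝ) : Prop where
  time_nonneg : 0 ≤ p.T
  state : Tame p.xe K
  control_u : Tame p.ue K
  control_a : Tame p.ae K
  state_vel : Tame p.vxe K
  control_vel : Tame p.vue K
  state_sub : ∀ a b, 0 ≤ a → a ≤ b → p.xe b - p.xe a = ∫ τ in a..b, p.vxe τ
  control_sub : ∀ a b, 0 ≤ a → a ≤ b → p.ue b - p.ue a = ∫ τ in a..b, p.vue τ

theorem Tame.mono {E : Type*} [NormedAddCommGroup E] {q : ℝ → E} {K K' : ℝ} (hq : Tame q K)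
    (h : K ≤ K') : Tame q K' :=
  ⟨hq.meas, fun t ht => (hq.bound t ht).trans h⟩

/-- Bounded variation on `[0, T]` bounds each of the two velocities and `a` by its norm at `0` plus
`μ`; the state and `u` are then Lipschitz, hence bounded on the interval. -/
theorem exists_tameReference {n d m s : ℕ} {D : Data n d m s} {p : ControlProcess n d} {μ : ℝ}
    (hp : IsFeasible D p) (hμ : 0 < μ) (hBV : BVBound p μ) : ∃ K, TameReference p K := by
  have hT := hp.time_nonneg
  have hvx := fun t ht => norm_le_of_eVariationOn_le (t := t) hT hμ.le hBV.var_vx ht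
  have hvu := fun t ht => norm_le_of_eVariationOn_le (t := t) hT hμ.le hBV.var_vu ht
  have ha := fun t ht => norm_le_of_eVariationOn_le (t := t) hT hμ.le hBV.var_a ht
  have t1 := Tame.extend hT hp.state hvx
  have t2 := Tame.extend hT hp.control_u hvu
  have t3 : Tame p.ae (‖p.a 0‖ + μ) := Tame.of_Icc (c := p.a p.T) hp.control_a.1 ha
    (ha _ (right_mem_Icc.2 hT)) (fun t ht => by rw [ControlProcess.ae, min_eq_left ht.2])
    (fun t ht => by rw [ControlProcess.ae, min_eq_right ht.le])
  have t4 := Tame.extend_derivative hT hp.state hvx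
  have t5 := Tame.extend_derivative hT hp.control_u hvu
  -- The bounds at time `0` show that all five summands of `K` are nonnegative, so that each is at
  -- most their sum.
  have e1 := t1.bound 0 le_rfl
  have e2 := t2.bound 0 le_rfl
  have e3 := t3.bound 0 le_rfl
  have e4 := t4.bound 0 le_rfl
  have e5 := t5.bound 0 le_rfl
  refine ⟨(‖p.x 0‖ + (‖p.vx 0‖ + μ) * p.T) + (‖p.u 0‖ + (‖p.vu 0‖ + μ) * p.T) + (‖p.a 0‖ + μ)
    + (‖p.vx 0‖ + μ) + (‖p.vu 0‖ + μ), hT, t1.mono ?_, t2.mono ?_, t3.mono ?_, t4.mono ?_,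
    t5.mono ?_, extend_sub_extend hT hp.state hvx, extend_sub_extend hT hp.control_u hvu⟩ <;>
  linarith [(norm_nonneg _).trans e1, (norm_nonneg _).trans e2, (norm_nonneg _).trans e3,
    (norm_nonneg _).trans e4, (norm_nonneg _).trans e5]

/-! ### Lower semicontinuity of extended real-valued sums -/

section EReal

variable {X : Type*} [TopologicalSpace X] {S : Set X} {z : X}

theorem coe_mul_ne_bot {c : ℝ} (hc : 0 < c) {e : EReal} (he : e ≠ ⊥) : (c : EReal) * e ≠ ⊥ := by
  induction e with
  | bot => exact absurd rfl he
  | coe r => rw [← EReal.coe_mul]; exact EReal.coe_ne_bot _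
  | top => rw [EReal.coe_mul_top_of_pos hc]; exact bot_ne_top.symm

/-- Multiplication in `EReal` is continuous at a pair whose first entry is a positive real. As `f`
is controlled only from below, its values have to be truncated at `f z` before this continuity can
be used. -/
theorem lowerSemicontinuousWithinAt_coe_mul {c : X → ℝ} {f : X → EReal}
    (hf : LowerSemicontinuousWithinAt f S z) (hc : ContinuousWithinAt c S z) (hpos : 0 < c z) :
    LowerSemicontinuousWithinAt (fun y => (c y : EReal) * f y) S z := by
  intro b hb
  have hcont : ContinuousAt (fun q : EReal × EReal => q.1 * q.2) ((c z : EReal), f z) := by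
    refine EReal.continuousAt_mul ?_ ?_ ?_ ?_
    · exact Or.inl (EReal.coe_ne_zero.2 hpos.ne')
    · exact Or.inl (EReal.coe_ne_zero.2 hpos.ne')
    · exact Or.inl (EReal.coe_ne_bot _)
    · exact Or.inl (EReal.coe_ne_top _)
  have hev : ∀ᶠ q : EReal × EReal in 𝓝 ((c z : EReal), f z), b < q.1 * q.2 :=
    hcont.eventually (lt_mem_nhds hb)
  rw [nhds_prod_eq] at hev
  obtain ⟨pa, ha, pb, hpb, hab⟩ := eventually_prod_iff.1 hev
  have hfz : ⊥ < f z := by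
    rw [bot_lt_iff_ne_bot]
    intro h
    simp only [h, EReal.coe_mul_bot_of_pos hpos] at hb
    exact not_lt_bot hb
  obtain ⟨l, hl, hsub⟩ := exists_Ioc_subset_of_mem_nhds hpb ⟨⊥, hfz⟩
  have hcc : Tendsto (fun y => (c y : EReal)) (𝓝[S] z) (𝓝 (c z : EReal)) :=
    (continuous_coe_real_ereal.tendsto _).comp hc
  filter_upwards [hf l hl, hcc.eventually ha, hc.eventually (lt_mem_nhds hpos)] with y h1 h2 h3
  -- The truncation `min (f y) (f z)` lies in `Ioc l (f z)`; monotonicity of multiplication by `c y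
  -- ≥ 0` then removes it.
  have := hab h2 (hsub ⟨lt_min h1 hl, min_le_right _ _⟩)
  exact this.trans_le (mul_le_mul_of_nonneg_left (min_le_left _ _) (EReal.coe_nonneg.2 h3.le))

/-- Addition in `EReal` is discontinuous only at `⊤ + ⊥`, which is excluded here. -/
theorem lowerSemicontinuousWithinAt_add_of_ne_bot {f g : X → EReal}
    (hf : LowerSemicontinuousWithinAt f S z) (hg : LowerSemicontinuousWithinAt g S z)
    (h1 : f z ≠ ⊥) (h2 : g z ≠ ⊥) : LowerSemicontinuousWithinAt (fun y => f y + g y) S z :=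
  hf.add' hg (EReal.continuousAt_add (Or.inr h2) (Or.inl h1))

theorem lowerSemicontinuousWithinAt_sum_of_ne_bot {ι : Type*} {f : ι → X → EReal} (s : Finset ι)
    (hf : ∀ i, LowerSemicontinuousWithinAt (f i) S z) (hz : ∀ i, f i z ≠ ⊥) :
    LowerSemicontinuousWithinAt (fun y => ∑ i ∈ s, f i y) S z ∧ ∑ i ∈ s, f i z ≠ ⊥ := by
  classical
  induction s using Finset.induction_on with
  | empty => simpa using continuousWithinAt_const.lowerSemicontinuousWithinAt
  | insert i s his ih =>
    simp_rw [Finset.sum_insert his]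
    exact ⟨lowerSemicontinuousWithinAt_add_of_ne_bot (hf i) ih.1 (hz i) ih.2,
      by rw [Ne, EReal.add_eq_bot_iff]; exact not_or.2 ⟨hz i, ih.2⟩⟩

end EReal

end

/-! ### Compactness of the discrete feasible set and semicontinuity of the cost -/

section

/-- A polygonal path on the uniform mesh whose slopes are close in `L²` to `q` stays close to a
primitive of `q`. -/
theorem Tame.dist_mesh_path_le {E : Type*} [NormedAddCommGroup E] [NormedSpace ℝ E]
    [CompleteSpace E] {q : ℝ → E} {K : ℝ} (hq : Tame q K) {y : ℝ → E}
    (hy : ∀ a b, 0 ≤ a → a ≤ b → y b - y a = ∫ τ in a..b, q τ) {k : ℕ} {h lam c : ℝ} (hh : 0 < h)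
    (hlam : 0 < lam) (X : Fin (k + 1) → E) (hX : X 0 = y 0)
    (hsum : ∑ i : Fin k, ∫ τ in ((i : ℕ) * h)..(((i : ℕ) + 1 : ℕ) * h),
      ‖h⁻¹ • (X i.succ - X i.castSucc) - q τ‖ ^ 2 ≤ c) (j : Fin (k + 1)) :
    ‖X j - y (j * h)‖ ≤ lam * (k * h) + lam⁻¹ * c := by
  have hmain := hq.dist_polygon_le hy hh hlam (fun i => X (Fin.ofNat (k + 1) i)) hX j
  simp only [Fin.ofNat_val_eq_self] at hmain
  refine hmain.trans (add_le_add ?_ (mul_le_mul_of_nonneg_left ?_ (inv_pos.2 hlam).le))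
  · have : ((j : ℕ) : ℝ) ≤ k := by exact_mod_cast Fin.is_le j
    gcongr
  · refine le_trans ?_ hsum
    let G : ℕ → ℝ := fun i => ∫ τ in (i * h)..((i + 1 : ℕ) * h),
      ‖h⁻¹ • (X (Fin.ofNat (k + 1) (i + 1)) - X (Fin.ofNat (k + 1) i)) - q τ‖ ^ 2
    have hterm : ∀ i : Fin k, (∫ τ in ((i : ℕ) * h)..(((i : ℕ) + 1 : ℕ) * h),
        ‖h⁻¹ • (X i.succ - X i.castSucc) - q τ‖ ^ 2) = G i := fun i => by
      have e1 : Fin.ofNat (k + 1) i = i.castSucc := by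
        ext; simp
      have e2 : Fin.ofNat (k + 1) (i + 1) = i.succ := by
        ext; simp
      simp only [G, e1, e2]
    rw [Finset.sum_congr rfl fun i _ => hterm i, Fin.sum_univ_eq_sum_range G k]
    refine Finset.sum_le_sum_of_subset_of_nonneg
      (Finset.range_mono (Fin.is_le j)) fun i _ _ => ?_
    refine intervalIntegral.integral_nonneg ?_ fun τ _ => by positivity
    push_cast; nlinarith

/-- The variables of the discrete problem as a point of a product space. -/
abbrev Vars (n d k : ℕ) : Type :=
  (Fin (k + 1) → Vec n) × (Fin (k + 1) → Vec n) × (Fin k → Vec d) × ℝ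

/-- The discrete process with given variables. -/
def ofVars {n d k : ℕ} (q : Vars n d k) : DiscreteProcess n d k := ⟨q.1, q.2.1, q.2.2.1, q.2.2.2⟩

section Continuity

variable {n d k : ℕ}

theorem continuous_h : Continuous fun q : Vars n d k => (ofVars q).h := by
  unfold DiscreteProcess.h ofVars; fun_prop

theorem continuous_t (j : ℕ) : Continuous fun q : Vars n d k => (ofVars q).t j := by
  unfold DiscreteProcess.t; exact continuous_const.mul continuous_h

theorem continuous_x (j : Fin (k + 1)) : Continuous fun q : Vars n d k => (ofVars q).x j := by
  unfold ofVars; fun_prop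

theorem continuous_u (j : Fin (k + 1)) : Continuous fun q : Vars n d k => (ofVars q).u j := by
  unfold ofVars; fun_prop

theorem continuous_a (j : Fin k) : Continuous fun q : Vars n d k => (ofVars q).a j := by
  unfold ofVars; fun_prop

theorem continuous_T : Continuous fun q : Vars n d k => (ofVars q).T := by
  unfold ofVars; fun_prop

theorem h_pos {z : DiscreteProcess n d k} (hk : 0 < k) (hT : 0 < z.T) : 0 < z.h :=
  div_pos hT (by exact_mod_cast hk)

theorem t_nonneg {z : DiscreteProcess n d k} (hT : 0 < z.T) (j : ℕ) : 0 ≤ z.t j :=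
  mul_nonneg (by positivity) (div_nonneg hT.le (by positivity))

theorem eventually_t_nonneg {q : Vars n d k} (hT : 0 < (ofVars q).T) (j : ℕ) :
    ∀ᶠ y in 𝓝 q, 0 ≤ (ofVars y).t j :=
  (continuous_T.continuousAt.eventually (lt_mem_nhds hT)).mono fun _ hy => t_nonneg hy j

variable {q : Vars n d k} (hk : 0 < k) (hT : 0 < (ofVars q).T)

include hk hT

/-- All difference quotients contain this factor, which is why their continuity is asserted only
where `T > 0`. -/
theorem continuousAt_h_inv : ContinuousAt (fun y : Vars n d k => (ofVars y).h⁻¹) q :=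
  continuous_h.continuousAt.inv₀ (h_pos hk hT).ne'

theorem continuousAt_dx (j : Fin k) : ContinuousAt (fun y : Vars n d k => (ofVars y).dx j) q :=
  (continuousAt_h_inv hk hT).smul ((continuous_x _).sub (continuous_x _)).continuousAt

theorem continuousAt_du (j : Fin k) : ContinuousAt (fun y : Vars n d k => (ofVars y).du j) q :=
  (continuousAt_h_inv hk hT).smul ((continuous_u _).sub (continuous_u _)).continuousAt

theorem continuousAt_firstQuot :
    ContinuousAt (fun y : Vars n d k => (ofVars y).firstQuot) q :=
  ((continuousAt_h_inv hk hT).smul ((continuous_u _).sub (continuous_u _)).continuousAt).norm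

theorem continuousAt_lastQuot :
    ContinuousAt (fun y : Vars n d k => (ofVars y).lastQuot) q :=
  ((continuousAt_h_inv hk hT).smul ((continuous_u _).sub (continuous_u _)).continuousAt).norm

theorem continuousAt_secondVar :
    ContinuousAt (fun y : Vars n d k => (ofVars y).secondVar) q := by
  unfold DiscreteProcess.secondVar
  have hu : ∀ j, Continuous fun y : Vars n d k => (ofVars y).uAt j := fun j => continuous_u _
  refine tendsto_finsetSum _ fun j _ => ?_
  have hj : Continuous fun y : Vars n d k =>
      (ofVars y).uAt (j + 1) - (2 : ℝ) • (ofVars y).uAt j + (ofVars y).uAt (j - 1) :=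
    ((hu _).sub ((hu _).const_smul (2 : ℝ))).add (hu _)
  exact ((continuousAt_h_inv hk hT).smul hj.continuousAt).norm

variable {p : ControlProcess n d} {K : ℝ} (hp : TameReference p K)

include hp

theorem continuousAt_velocity_error (j : Fin k) : ContinuousAt (fun y : Vars n d k =>
    ∫ τ in ((ofVars y).t j)..((ofVars y).t (j + 1)),
      (‖(ofVars y).dx j - p.vxe τ‖ ^ 2 + ‖(ofVars y).du j - p.vue τ‖ ^ 2)) q := by
  have e1 := eventually_t_nonneg hT j
  have e2 := eventually_t_nonneg hT (j + 1)
  have c1 := (continuous_t (n := n) (d := d) (k := k) j).continuousAt (x := q)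
  have c2 := (continuous_t (n := n) (d := d) (k := k) (j + 1)).continuousAt (x := q)
  refine ((hp.state_vel.continuousAt_integral_sq (continuousAt_dx hk hT j) c1 c2 e1 e2).add
    (hp.control_vel.continuousAt_integral_sq (continuousAt_du hk hT j) c1 c2 e1 e2)).congr ?_
  filter_upwards [e1, e2] with y h1 h2
  exact (intervalIntegral.integral_add (hp.state_vel.intervalIntegrable_sq _ h1 h2)
    (hp.control_vel.intervalIntegrable_sq _ h1 h2)).symm

/-- In `cost` the integrand extends over the two squared distance penalties as well. They are
constant in `τ` and appear here as `c₁` and `c₂`, each contributing the cell length times its value.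
-/
theorem continuousAt_cost_integral {c₁ c₂ : Vars n d k → ℝ} (hc₁ : ContinuousAt c₁ q)
    (hc₂ : ContinuousAt c₂ q) (j : Fin k) : ContinuousAt (fun y : Vars n d k =>
    ∫ τ in ((ofVars y).t j)..((ofVars y).t (j + 1)),
      ((‖(ofVars y).a j - p.ae τ‖ ^ 2 + ‖(ofVars y).dx j - p.vxe τ‖ ^ 2
        + ‖(ofVars y).du j - p.vue τ‖ ^ 2) + c₁ y + c₂ y)) q := by
  have e1 := eventually_t_nonneg hT j
  have e2 := eventually_t_nonneg hT (j + 1)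
  have c1 := (continuous_t (n := n) (d := d) (k := k) j).continuousAt (x := q)
  have c2 := (continuous_t (n := n) (d := d) (k := k) (j + 1)).continuousAt (x := q)
  refine (((((hp.control_a.continuousAt_integral_sq
    (continuous_a j).continuousAt c1 c2 e1 e2).add
    (hp.state_vel.continuousAt_integral_sq (continuousAt_dx hk hT j) c1 c2 e1 e2)).add
    (hp.control_vel.continuousAt_integral_sq (continuousAt_du hk hT j) c1 c2 e1 e2)).add
    ((c2.sub c1).mul hc₁)).add ((c2.sub c1).mul hc₂)).congr ?_
  filter_upwards [e1, e2] with y h1 h2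
  have i1 := hp.control_a.intervalIntegrable_sq ((ofVars y).a j) h1 h2
  have i2 := hp.state_vel.intervalIntegrable_sq ((ofVars y).dx j) h1 h2
  have i3 := hp.control_vel.intervalIntegrable_sq ((ofVars y).du j) h1 h2
  have i4 := (i1.add i2).add i3
  rw [intervalIntegral.integral_add (i4.add intervalIntegrable_const) intervalIntegrable_const,
    intervalIntegral.integral_add i4 intervalIntegrable_const,
    intervalIntegral.integral_add (i1.add i2) i3, intervalIntegral.integral_add i1 i2,
    intervalIntegral.integral_const, intervalIntegral.integral_const]
  rfl

omit hk in
theorem continuousAt_value_error (j : Fin k) : ContinuousAt (fun y : Vars n d k =>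
    ∫ τ in ((ofVars y).t j)..((ofVars y).t (j + 1)),
      (‖(ofVars y).x j.castSucc - p.xe τ‖ ^ 2 + ‖(ofVars y).u j.castSucc - p.ue τ‖ ^ 2
        + ‖(ofVars y).a j - p.ae τ‖ ^ 2)) q := by
  have e1 := eventually_t_nonneg hT j
  have e2 := eventually_t_nonneg hT (j + 1)
  have c1 := (continuous_t (n := n) (d := d) (k := k) j).continuousAt (x := q)
  have c2 := (continuous_t (n := n) (d := d) (k := k) (j + 1)).continuousAt (x := q)
  refine (((hp.state.continuousAt_integral_sq (continuous_x j.castSucc).continuousAt c1 c2 e1 e2).add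
    (hp.control_u.continuousAt_integral_sq (continuous_u j.castSucc).continuousAt c1 c2 e1 e2)).add
    (hp.control_a.continuousAt_integral_sq (continuous_a j).continuousAt c1 c2 e1 e2)).congr ?_
  filter_upwards [e1, e2] with y h1 h2
  have i1 := hp.state.intervalIntegrable_sq ((ofVars y).x j.castSucc) h1 h2
  have i2 := hp.control_u.intervalIntegrable_sq ((ofVars y).u j.castSucc) h1 h2
  have i3 := hp.control_a.intervalIntegrable_sq ((ofVars y).a j) h1 h2
  rw [intervalIntegral.integral_add (i1.add i2) i3, intervalIntegral.integral_add i1 i2]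
  rfl

end Continuity

variable {n d m s k : ℕ} {D : Data n d m s} {p : ControlProcess n d} {Lf Lν μ ε K : ℝ}

/-- The prescribed initial values and the L² constraint on the velocities control the whole path.
The choice `lam = 1` gives boundedness; a small `lam` localizes the endpoint. -/
theorem dist_reference_le (hp : TameReference p K) (hx0 : p.x 0 = D.x₀) (hk : 0 < k)
    {z : DiscreteProcess n d k} (hz : z.Feasible D p Lf Lν μ ε) {lam : ℝ} (hlam : 0 < lam)
    (j : Fin (k + 1)) :
    ‖z.x j - p.xe (z.t j)‖ ≤ lam * z.T + lam⁻¹ * (ε / 2) ∧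
      ‖z.u j - p.ue (z.t j)‖ ≤ lam * z.T + lam⁻¹ * (ε / 2) := by
  have hh := h_pos hk hz.time_pos
  have hkh : (k : ℝ) * z.h = z.T := by
    unfold DiscreteProcess.h
    field_simp
  have hle : ∀ j : Fin k, z.t j ≤ z.t (j + 1) := fun j => by
    unfold DiscreteProcess.t; push_cast; nlinarith
  have i1 := fun j : Fin k => hp.state_vel.intervalIntegrable_sq (z.dx j)
    (t_nonneg hz.time_pos j) (t_nonneg hz.time_pos (j + 1))
  have i2 := fun j : Fin k => hp.control_vel.intervalIntegrable_sq (z.du j)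
    (t_nonneg hz.time_pos j) (t_nonneg hz.time_pos (j + 1))
  rw [← hkh]
  constructor
  · refine hp.state_vel.dist_mesh_path_le hp.state_sub hh hlam z.x ?_ ?_ j
    · rw [hz.initial_x, ControlProcess.xe, min_eq_left hp.time_nonneg, hx0]
    · refine le_trans (Finset.sum_le_sum fun j _ => ?_) hz.local_velocities
      exact intervalIntegral.integral_mono_on (hle j) (i1 j) ((i1 j).add (i2 j))
        fun τ _ => le_add_of_nonneg_right (by positivity)
  · refine hp.control_vel.dist_mesh_path_le hp.control_sub hh hlam z.u ?_ ?_ j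
    · rw [hz.initial_u, ControlProcess.ue, min_eq_left hp.time_nonneg]
    · refine le_trans (Finset.sum_le_sum fun j _ => ?_) hz.local_velocities
      exact intervalIntegral.integral_mono_on (hle j) (i2 j) ((i1 j).add (i2 j))
        fun τ _ => le_add_of_nonneg_left (by positivity)

/-- `Ex` and `ET` are closed pieces of the endpoint sets that suffice for every feasible process;
they allow for `D.Ξx` and `D.ΞT` being closed only locally. -/
theorem isClosed_feasible (hp : TameReference p K) (hk : 0 < k) (hε : ε < p.T)
    (hC : IsClosed D.C) (hf : Continuous fun q : Vec n × Vec d => D.f q.1 q.2)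
    (hν : ∀ i, Continuous (D.ν i)) (hA : IsClosed D.A) {Ex : Set (Vec n)} {ET : Set ℝ}
    (hEx : IsClosed Ex) (hET : IsClosed ET) (hExs : Ex ⊆ D.Ξx) (hETs : ET ⊆ D.ΞT)
    (hloc : ∀ z : DiscreteProcess n d k, z.Feasible D p Lf Lν μ ε →
      z.x (Fin.last k) ∈ Ex + Metric.closedBall 0 (muX Lf μ p.T k) ∧
      z.T ∈ ET + Metric.closedBall 0 (muX Lf μ p.T k)) :
    IsClosed {q : Vars n d k | (ofVars q).Feasible D p Lf Lν μ ε} := by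
  refine isClosed_of_closure_subset fun q hq => ?_
  have hne : (𝓝[{q : Vars n d k | (ofVars q).Feasible D p Lf Lν μ ε}] q).NeBot :=
    mem_closure_iff_nhdsWithin_neBot.1 hq
  have hmem : ∀ᶠ y in 𝓝[{q : Vars n d k | (ofVars q).Feasible D p Lf Lν μ ε}] q,
    (ofVars y).Feasible D p Lf Lν μ ε := self_mem_nhdsWithin
  set F := 𝓝[{q : Vars n d k | (ofVars q).Feasible D p Lf Lν μ ε}] q with hF
  have hFle : F ≤ 𝓝 q := nhdsWithin_le_nhds
  -- This closed constraint is treated first: with `ε < p.T` it preserves the strict inequality `T >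
  -- 0` in the limit, and so the continuity of all quotients at `q`.
  have htl : |(ofVars q).T - p.T| ≤ ε :=
    le_of_tendsto (((continuous_T.sub continuous_const).abs.tendsto q).mono_left hFle)
      (hmem.mono fun y hy => hy.time_local)
  have hT : 0 < (ofVars q).T := by linarith [(abs_le.1 htl).1]
  have hh := h_pos hk hT
  have cx := fun j => (continuous_x (n := n) (d := d) (k := k) j)
  have cu := fun j => (continuous_u (n := n) (d := d) (k := k) j)
  have ca := fun j => (continuous_a (n := n) (d := d) (k := k) j)
  have hclosed : ∀ S : Set (Vec n), IsClosed S →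
      IsClosed (S + Metric.closedBall (0 : Vec n) (muX Lf μ p.T k)) := fun S hS =>
    hS.add_right_of_isCompact (isCompact_closedBall _ _)
  have hclosed' : ∀ S : Set ℝ, IsClosed S →
      IsClosed (S + Metric.closedBall (0 : ℝ) (muX Lf μ p.T k)) := fun S hS =>
    hS.add_right_of_isCompact (isCompact_closedBall _ _)
  refine
    { time_pos := hT
      dynamics := fun j => ?_
      initial_x := ?_
      initial_u := ?_
      endpoint := ?_
      endtime := ?_
      time_local := htl
      u_mem := fun j i => ?_
      a_mem := fun j => ?_
      local_values := ?_
      local_velocities := ?_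
      end_quots := ?_
      second_var := ?_ }
  -- Solved for the normal vector, the dynamics read `f(x_j, a_j) - dx_j ∈ N_C(x_j - u_j)`, a
  -- condition on the graph of the normal cone.
  · have hlim : ContinuousAt (fun y : Vars n d k =>
        (((ofVars y).x j.castSucc - (ofVars y).u j.castSucc : Vec n),
        D.f ((ofVars y).x j.castSucc) ((ofVars y).a j) - (ofVars y).dx j)) q := by
      refine ContinuousAt.prodMk ((cx _).sub (cu _)).continuousAt ?_
      exact (hf.comp ((cx _).prodMk (ca _))).continuousAt.sub (continuousAt_dx hk hT j)
    have hin := (isClosed_graph_normalCone hC).mem_of_tendsto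
      (Tendsto.mono_left hlim hFle) (hmem.mono fun y hy => by
        obtain ⟨w, ⟨v, hv, rfl⟩, hw⟩ := hy.dynamics j
        have hhy := h_pos hk hy.time_pos
        have : D.f ((ofVars y).x j.castSucc) ((ofVars y).a j) - (ofVars y).dx j = v := by
          rw [DiscreteProcess.dx, hw, sub_sub_cancel_left, smul_neg, inv_smul_smul₀ hhy.ne']
          abel
        simpa [this] using hv)
    refine ⟨_, ⟨_, hin, rfl⟩, ?_⟩
    rw [sub_sub_cancel_left, smul_neg, DiscreteProcess.dx, smul_inv_smul₀ hh.ne']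
    abel
  · exact tendsto_nhds_unique (((cx 0).tendsto q).mono_left hFle)
      (tendsto_const_nhds.congr' (hmem.mono fun y hy => hy.initial_x.symm))
  · exact tendsto_nhds_unique (((cu 0).tendsto q).mono_left hFle)
      (tendsto_const_nhds.congr' (hmem.mono fun y hy => hy.initial_u.symm))
  · exact add_subset_add_right hExs ((hclosed Ex hEx).mem_of_tendsto
      (((cx (Fin.last k)).tendsto q).mono_left hFle) (hmem.mono fun y hy => (hloc _ hy).1))
  · exact add_subset_add_right hETs ((hclosed' ET hET).mem_of_tendsto
      ((continuous_T.tendsto q).mono_left hFle) (hmem.mono fun y hy => (hloc _ hy).2))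
  · exact le_of_tendsto ((((hν i).comp (cu _)).tendsto q).mono_left hFle)
      (hmem.mono fun y hy => hy.u_mem j i)
  · exact hA.mem_of_tendsto (((ca j).tendsto q).mono_left hFle) (hmem.mono fun y hy => hy.a_mem j)
  · exact le_of_tendsto (tendsto_finsetSum _ fun j _ =>
      Tendsto.mono_left (continuousAt_value_error hT hp j) hFle)
      (hmem.mono fun y hy => hy.local_values)
  · exact le_of_tendsto (tendsto_finsetSum _ fun j _ =>
      Tendsto.mono_left (continuousAt_velocity_error hk hT hp j) hFle)
      (hmem.mono fun y hy => hy.local_velocities)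
  · exact le_of_tendsto (Tendsto.mono_left
      ((continuousAt_firstQuot hk hT).max (continuousAt_lastQuot hk hT)) hFle)
      (hmem.mono fun y hy => hy.end_quots)
  · exact le_of_tendsto (Tendsto.mono_left (continuousAt_secondVar hk hT) hFle)
      (hmem.mono fun y hy => hy.second_var)

theorem feasible_subset_prod (hp : TameReference p K) (hx0 : p.x 0 = D.x₀) (hk : 0 < k) :
    {q : Vars n d k | (ofVars q).Feasible D p Lf Lν μ ε} ⊆
      (univ.pi fun _ => Metric.closedBall 0 (K + (p.T + ε) + ε / 2)) ×ˢ
      (univ.pi fun _ => Metric.closedBall 0 (K + (p.T + ε) + ε / 2)) ×ˢ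
      (univ.pi fun _ => D.A) ×ˢ Icc (p.T - ε) (p.T + ε) := by
  intro q hq
  have hT := abs_le.1 hq.time_local
  have hb := fun j => dist_reference_le hp hx0 hk hq one_pos j
  simp only [one_mul, inv_one] at hb
  refine ⟨fun j _ => ?_, fun j _ => ?_, fun j _ => hq.a_mem j, by
    show p.T - ε ≤ (ofVars q).T; linarith, by show (ofVars q).T ≤ p.T + ε; linarith⟩
  · rw [mem_closedBall_zero_iff]
    have h1 := hp.state.bound _ (t_nonneg hq.time_pos j)
    have h2 := norm_sub_norm_le ((ofVars q).x j) (p.xe ((ofVars q).t j))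
    have h3 := (hb j).1
    show ‖(ofVars q).x j‖ ≤ _
    linarith
  · rw [mem_closedBall_zero_iff]
    have h1 := hp.control_u.bound _ (t_nonneg hq.time_pos j)
    have h2 := norm_sub_norm_le ((ofVars q).u j) (p.ue ((ofVars q).t j))
    have h3 := (hb j).2
    show ‖(ofVars q).u j‖ ≤ _
    linarith

/-- Where `T > 0`, the arguments of `φ` and `ℓ` depend continuously on the variables, the weights
`h` are positive, and all the remaining terms are continuous. -/
theorem lowerSemicontinuousOn_cost (hp : TameReference p K) (hk : 0 < k)
    (hcost : D.CostAssumption) {S : Set (Vars n d k)} (hS : ∀ q ∈ S, 0 < (ofVars q).T) :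
    LowerSemicontinuousOn (fun q => (ofVars q).cost D p Lf μ) S := by
  intro q hq
  have hT := hS q hq
  have cx := fun j => (continuous_x (n := n) (d := d) (k := k) j)
  have cu := fun j => (continuous_u (n := n) (d := d) (k := k) j)
  have ca := fun j => (continuous_a (n := n) (d := d) (k := k) j)
  have hφ : LowerSemicontinuousWithinAt
      (fun y : Vars n d k => D.φ ((ofVars y).x (Fin.last k), (ofVars y).T)) S q :=
    hcost.terminal_lsc.comp ((cx _).prodMk continuous_T).continuousOn
      (fun y hy => ⟨mem_univ _, (hS y hy).le⟩) q hq
  have hℓ : ∀ j : Fin k, LowerSemicontinuousWithinAt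
      (fun y : Vars n d k => D.ℓ ((ofVars y).t j, (ofVars y).x j.castSucc, (ofVars y).u j.castSucc,
        (ofVars y).a j, (ofVars y).dx j, (ofVars y).du j)) S q := fun j => by
    refine hcost.running_lsc.comp (g := fun y : Vars n d k => ((ofVars y).t j,
      (ofVars y).x j.castSucc, (ofVars y).u j.castSucc,
        (ofVars y).a j, (ofVars y).dx j, (ofVars y).du j)) (fun y hy => ?_)
      (fun y hy => ⟨t_nonneg (hS y hy) j, mem_univ _⟩) q hq
    exact ((continuous_t _).continuousAt.prodMk ((cx _).continuousAt.prodMk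
      ((cu _).continuousAt.prodMk ((ca _).continuousAt.prodMk
      ((continuousAt_dx hk (hS y hy) j).prodMk
        (continuousAt_du hk (hS y hy) j)))))).continuousWithinAt
  have hh := h_pos hk hT
  have hsum := lowerSemicontinuousWithinAt_sum_of_ne_bot Finset.univ
    (fun j => lowerSemicontinuousWithinAt_coe_mul (hℓ j) continuous_h.continuousWithinAt hh)
    (fun j => coe_mul_ne_bot hh (hcost.running_ne_bot _))
  refine lowerSemicontinuousWithinAt_add_of_ne_bot
    (lowerSemicontinuousWithinAt_add_of_ne_bot hφ hsum.1 (hcost.terminal_ne_bot _) hsum.2) ?_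
    (by rw [Ne, EReal.add_eq_bot_iff]; exact not_or.2 ⟨hcost.terminal_ne_bot _, hsum.2⟩)
    (EReal.coe_ne_bot _)
  refine ContinuousWithinAt.lowerSemicontinuousWithinAt ?_
  refine ContinuousAt.continuousWithinAt (continuous_coe_real_ereal.continuousAt.comp ?_)
  refine ContinuousAt.add ?_ ?_
  · exact (continuous_const.mul ((continuous_T.sub continuous_const).pow 2)).continuousAt
  · exact continuousAt_const.mul (tendsto_finsetSum _ fun j _ =>
      continuousAt_cost_integral hk hT hp
        (((Metric.continuous_infDist_pt _).continuousAt.comp (continuousAt_firstQuot hk hT)).pow 2)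
        (((Metric.continuous_infDist_pt _).continuousAt.comp (continuousAt_secondVar hk hT)).pow 2)
        j)

/-- If the endpoint constraints of a discrete problem with a feasible process may be replaced by
closed ones, then every lower semicontinuous functional attains its minimum over the feasible
processes. -/
theorem exists_minimizer_of_feasible (hp : TameReference p K) (hx0 : p.x 0 = D.x₀) (hk : 0 < k)
    (hε : ε < p.T)
    (hC : IsClosed D.C) (hf : Continuous fun q : Vec n × Vec d => D.f q.1 q.2)
    (hν : ∀ i, Continuous (D.ν i)) (hA : IsCompact D.A)
    {Ex : Set (Vec n)} {ET : Set ℝ}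
    (hEx : IsClosed Ex) (hET : IsClosed ET) (hExs : Ex ⊆ D.Ξx) (hETs : ET ⊆ D.ΞT)
    (hloc : ∀ z : DiscreteProcess n d k, z.Feasible D p Lf Lν μ ε →
      z.x (Fin.last k) ∈ Ex + Metric.closedBall 0 (muX Lf μ p.T k) ∧
      z.T ∈ ET + Metric.closedBall 0 (muX Lf μ p.T k))
    (hne : ∃ z : DiscreteProcess n d k, z.Feasible D p Lf Lν μ ε)
    {J : DiscreteProcess n d k → EReal}
    (hJ : LowerSemicontinuousOn (fun q => J (ofVars q)) {q : Vars n d k | 0 < (ofVars q).T}) :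
    ∃ z : DiscreteProcess n d k, z.Feasible D p Lf Lν μ ε ∧
      ∀ z' : DiscreteProcess n d k, z'.Feasible D p Lf Lν μ ε → J z ≤ J z' := by
  have hcomp : IsCompact {q : Vars n d k | (ofVars q).Feasible D p Lf Lν μ ε} := by
    refine IsCompact.of_isClosed_subset ?_
      (isClosed_feasible hp hk hε hC hf hν hA.isClosed hEx hET hExs hETs hloc)
      (feasible_subset_prod hp hx0 hk)
    exact (isCompact_univ_pi fun _ => isCompact_closedBall _ _).prod
      ((isCompact_univ_pi fun _ => isCompact_closedBall _ _).prod
        ((isCompact_univ_pi fun _ => hA).prod isCompact_Icc))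
  obtain ⟨z₀, hz₀⟩ := hne
  obtain ⟨q, hq, hmin⟩ := LowerSemicontinuousOn.exists_isMinOn (s := {q : Vars n d k |
    (ofVars q).Feasible D p Lf Lν μ ε}) ⟨(z₀.x, z₀.u, z₀.a, z₀.T), hz₀⟩ hcomp
    (hJ.mono fun q (hq : (ofVars q).Feasible D p Lf Lν μ ε) => hq.time_pos)
  exact ⟨ofVars q, hq, fun z hz =>
    hmin (show (z.x, z.u, z.a, z.T) ∈ {q : Vars n d k | (ofVars q).Feasible D p Lf Lν μ ε} from hz)⟩

end

/-! ### Gronwall estimate, cell variations and right limits -/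

section

/-- A discrete Gronwall inequality. -/
theorem discrete_gronwall {E : Type*} [NormedAddCommGroup E] {e : ℕ → E} {w : ℕ → ℝ} {h L : ℝ}
    {k : ℕ} (hh : 0 ≤ h) (hL : 0 ≤ L) (hw : ∀ j, 0 ≤ w j) (he0 : e 0 = 0)
    (he : ∀ j < k, ‖e (j + 1) - e j‖ ≤ h * (L * ‖e j‖ + w j)) :
    ∀ j ≤ k, ‖e j‖ ≤ Real.exp (L * (j * h)) * (h * ∑ i ∈ Finset.range j, w i) := by
  intro j
  induction j with
  | zero => simp [he0]
  | succ j ih =>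
    intro hj
    have h1 := ih (by omega)
    have h2 := he j (by omega)
    have h3 : ‖e (j + 1)‖ ≤ ‖e (j + 1) - e j‖ + ‖e j‖ := by
      simpa using norm_add_le (e (j + 1) - e j) (e j)
    have hS : 0 ≤ h * ∑ i ∈ Finset.range j, w i :=
      mul_nonneg hh (Finset.sum_nonneg fun i _ => hw i)
    set S := h * ∑ i ∈ Finset.range j, w i
    have hexp : (1 + L * h) * Real.exp (L * (j * h)) ≤ Real.exp (L * ((j + 1 : ℕ) * h)) := by
      have : Real.exp (L * ((j + 1 : ℕ) * h)) = Real.exp (L * h) * Real.exp (L * (j * h)) := by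
        rw [← Real.exp_add]; congr 1; push_cast; ring
      rw [this]
      gcongr
      linarith [Real.add_one_le_exp (L * h)]
    have hone : 1 ≤ Real.exp (L * ((j + 1 : ℕ) * h)) := Real.one_le_exp (by positivity)
    rw [Finset.sum_range_succ, mul_add]
    have hLh : 0 ≤ L * h := by positivity
    have hwj : 0 ≤ h * w j := mul_nonneg hh (hw j)
    calc ‖e (j + 1)‖ ≤ (1 + L * h) * ‖e j‖ + h * w j := by linarith
      _ ≤ (1 + L * h) * (Real.exp (L * (j * h)) * S) + h * w j := by gcongr
      _ = ((1 + L * h) * Real.exp (L * (j * h))) * S + h * w j := by ring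
      _ ≤ Real.exp (L * ((j + 1 : ℕ) * h)) * S + Real.exp (L * ((j + 1 : ℕ) * h)) * (h * w j) := by
        exact add_le_add (mul_le_mul_of_nonneg_right hexp hS) (le_mul_of_one_le_left hwj hone)
      _ = _ := by ring

section Variation

variable {E : Type*} [NormedAddCommGroup E] {q : ℝ → E} {h c : ℝ} {k : ℕ}

/-- The variation of `q` on the `j`-th cell of the mesh of size `h`. -/
def cellVar (q : ℝ → E) (h : ℝ) (j : ℕ) : ℝ :=
  (eVariationOn q (Icc (j * h) ((j + 1 : ℕ) * h))).toReal

theorem cellVar_nonneg (j : ℕ) : 0 ≤ cellVar q h j := ENNReal.toReal_nonneg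

theorem sum_cellVar_le (hh : 0 ≤ h) (hc : 0 ≤ c)
    (hq : eVariationOn q (Icc 0 (k * h)) ≤ ENNReal.ofReal c) :
    ∑ j ∈ Finset.range k, cellVar q h j ≤ c := by
  have hm : Monotone fun j : ℕ => (j : ℝ) * h := fun i j hij => by
    have : (i : ℝ) ≤ j := by exact_mod_cast hij
    show (i : ℝ) * h ≤ j * h
    gcongr
  have hs := eVariationOn.sum' q hm (n := k)
  simp only [Nat.cast_zero, zero_mul] at hs
  rw [← hs] at hq
  unfold cellVar
  rw [← ENNReal.toReal_sum]
  · exact ENNReal.toReal_le_of_le_ofReal hc hq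
  · intro j hj
    exact ne_top_of_le_ne_top ENNReal.ofReal_ne_top ((Finset.single_le_sum
      (f := fun j : ℕ => eVariationOn q (Icc ((j : ℝ) * h) (((j + 1 : ℕ) : ℝ) * h)))
      (fun _ _ => zero_le) hj).trans hq)

theorem cellVar_le (hh : 0 ≤ h) (hc : 0 ≤ c)
    (hq : eVariationOn q (Icc 0 (k * h)) ≤ ENNReal.ofReal c) {j : ℕ} (hj : j < k) :
    cellVar q h j ≤ c :=
  (Finset.single_le_sum (fun i _ => cellVar_nonneg i) (Finset.mem_range.2 hj)).trans
    (sum_cellVar_le hh hc hq)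

theorem cell_subset (hh : 0 ≤ h) {j : ℕ} (hj : j < k) :
    Icc ((j : ℝ) * h) ((j + 1 : ℕ) * h) ⊆ Icc 0 (k * h) := by
  have : ((j + 1 : ℕ) : ℝ) ≤ k := by exact_mod_cast hj
  exact Icc_subset_Icc (by positivity) (by gcongr)

theorem norm_sub_le_cellVar (hh : 0 ≤ h)
    (hq : eVariationOn q (Icc 0 (k * h)) ≤ ENNReal.ofReal c) {j : ℕ} (hj : j < k) {a b : ℝ}
    (ha : a ∈ Icc ((j : ℝ) * h) ((j + 1 : ℕ) * h))
    (hb : b ∈ Icc ((j : ℝ) * h) ((j + 1 : ℕ) * h)) : ‖q a - q b‖ ≤ cellVar q h j := by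
  have hbv : BoundedVariationOn q (Icc ((j : ℝ) * h) ((j + 1 : ℕ) * h)) :=
    ne_top_of_le_ne_top ENNReal.ofReal_ne_top
      ((eVariationOn.mono q (cell_subset hh hj)).trans hq)
  rw [← dist_eq_norm]
  exact hbv.dist_le ha hb

variable {K : ℝ} [NormedSpace ℝ E]

/-- The mean of a tame function over a cell. -/
theorem Tame.norm_mean_sub_le [CompleteSpace E] (hq : Tame q K) (hh : 0 < h) {v : E} {j : ℕ}
    {y : ℝ → E} (hy : ∀ a b, 0 ≤ a → a ≤ b → y b - y a = ∫ τ in a..b, q τ)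
    (hv : ∀ τ ∈ Icc ((j : ℝ) * h) ((j + 1 : ℕ) * h), ‖q τ - v‖ ≤ c) :
    ‖h⁻¹ • (y ((j + 1 : ℕ) * h) - y (j * h)) - v‖ ≤ c := by
  have ha : (0 : ℝ) ≤ j * h := by positivity
  have hb : (0 : ℝ) ≤ (j + 1 : ℕ) * h := by positivity
  have hlen : ((j + 1 : ℕ) : ℝ) * h - j * h = h := by push_cast; ring
  have hab : (j : ℝ) * h ≤ (j + 1 : ℕ) * h := by linarith
  have heq : h⁻¹ • (y ((j + 1 : ℕ) * h) - y (j * h)) - v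
      = h⁻¹ • ∫ τ in (j * h)..((j + 1 : ℕ) * h), (q τ - v) := by
    rw [hy _ _ ha hab, intervalIntegral.integral_sub (hq.intervalIntegrable ha hb)
      intervalIntegrable_const, intervalIntegral.integral_const, hlen, smul_sub,
      inv_smul_smul₀ hh.ne']
  have hle := intervalIntegral.norm_integral_le_of_norm_le_const (a := (j : ℝ) * h)
    (b := (j + 1 : ℕ) * h) (f := fun τ => q τ - v) (C := c) fun τ hτ => by
      rw [uIoc_of_le hab] at hτ
      exact hv τ (Ioc_subset_Icc_self hτ)
  rw [heq, norm_smul, norm_inv, Real.norm_of_nonneg hh.le]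
  rw [hlen, abs_of_pos hh] at hle
  calc _ ≤ h⁻¹ * (c * h) := by gcongr
    _ = c := by field_simp

/-- The second differences of a primitive of a function of bounded variation. -/
theorem Tame.sum_norm_second_difference_le [CompleteSpace E] (hq : Tame q K) (hk : 0 < k) (hh : 0 < h)
    (hc : 0 ≤ c) (hvar : eVariationOn q (Icc 0 (k * h)) ≤ ENNReal.ofReal c)
    {y : ℝ → E} (hy : ∀ a b, 0 ≤ a → a ≤ b → y b - y a = ∫ τ in a..b, q τ) :
    ∑ i ∈ Finset.range (k - 1), ‖(y ((i + 1 + 1 : ℕ) * h) - y ((i + 1 : ℕ) * h))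
      - (y ((i + 1 : ℕ) * h) - y (i * h))‖ ≤ h * c := by
  -- All cells are translated to `[0, h]`, so that the sum over cells can be taken under a single
  -- integral.
  have hshift : ∀ i : ℕ, y ((i + 1 : ℕ) * h) - y (i * h) = ∫ s in (0 : ℝ)..h, q (s + i * h) :=
    fun i => by
      rw [intervalIntegral.integral_comp_add_right (fun s => q s), zero_add,
        hy _ _ (by positivity) (by push_cast; nlinarith)]
      congr 1
      push_cast; ring
  have hint : ∀ i : ℕ, IntervalIntegrable (fun s => q (s + i * h)) volume 0 h := fun i => by
    have := (hq.intervalIntegrable (a := i * h) (b := (i + 1 : ℕ) * h) (by positivity)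
      (by positivity)).comp_add_right (i * h)
    convert this using 1
    · ring
    · push_cast; ring
  have hint2 : ∀ i ∈ Finset.range (k - 1), IntervalIntegrable
      (fun s => ‖q (s + (i + 1 : ℕ) * h) - q (s + i * h)‖) volume 0 h :=
    fun i _ => ((hint (i + 1)).sub (hint i)).norm
  calc _ ≤ ∑ i ∈ Finset.range (k - 1),
        ∫ s in (0 : ℝ)..h, ‖q (s + (i + 1 : ℕ) * h) - q (s + i * h)‖ := by
        refine Finset.sum_le_sum fun i _ => ?_
        rw [hshift (i + 1), hshift i, ← intervalIntegral.integral_sub (hint _) (hint _)]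
        exact intervalIntegral.norm_integral_le_integral_norm hh.le
    _ = ∫ s in (0 : ℝ)..h, ∑ i ∈ Finset.range (k - 1),
        ‖q (s + (i + 1 : ℕ) * h) - q (s + i * h)‖ :=
        (intervalIntegral.integral_finsetSum hint2).symm
    _ ≤ ∫ _ in (0 : ℝ)..h, c := by
        have hsumint : IntervalIntegrable (fun s => ∑ i ∈ Finset.range (k - 1),
            ‖q (s + (i + 1 : ℕ) * h) - q (s + i * h)‖) volume 0 h := by
          simpa only [Finset.sum_fn] using IntervalIntegrable.sum (Finset.range (k - 1)) hint2
        refine intervalIntegral.integral_mono_on hh.le hsumint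
          intervalIntegrable_const fun s hs => ?_
        -- For fixed `s ∈ [0, h]` the points `s + i * h`, `i ≤ k - 1`, form an increasing chain in
        -- `[0, k * h]`, so the increments of `q` along it sum to at most the variation.
        have hsum := (eVariationOn.sum_le_of_monotoneOn_Iic (f := q) (s := Icc 0 (k * h))
          (n := k - 1) (u := fun i : ℕ => s + i * h) (fun i _ j _ hij => by
            have : (i : ℝ) ≤ j := by exact_mod_cast hij
            show s + i * h ≤ s + j * h
            gcongr) (fun i hi => ?_)).trans hvar
        · simp_rw [edist_dist, dist_eq_norm] at hsum
          rwa [← ENNReal.ofReal_sum_of_nonneg fun _ _ => norm_nonneg _,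
            ENNReal.ofReal_le_ofReal_iff hc] at hsum
        · have hik : (i : ℝ) + 1 ≤ k := by exact_mod_cast (by omega : i + 1 ≤ k)
          have := hs.1
          constructor
          · positivity
          · nlinarith [hs.2]
    _ = h * c := by simp

end Variation

theorem TameReference.norm_xe_sub_le {n d : ℕ} {p : ControlProcess n d} {K : ℝ}
    (hp : TameReference p K) {a b : ℝ} (ha : 0 ≤ a) (hab : a ≤ b) :
    ‖p.xe b - p.xe a‖ ≤ K * (b - a) := by
  rw [hp.state_sub a b ha hab, ← abs_of_nonneg (sub_nonneg.2 hab)]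
  refine intervalIntegral.norm_integral_le_of_norm_le_const fun τ hτ => ?_
  rw [uIoc_of_le hab] at hτ
  exact hp.state_vel.bound τ (ha.trans hτ.1.le)

theorem TameReference.norm_ue_sub_le {n d : ℕ} {p : ControlProcess n d} {K : ℝ}
    (hp : TameReference p K) {a b : ℝ} (ha : 0 ≤ a) (hab : a ≤ b) :
    ‖p.ue b - p.ue a‖ ≤ K * (b - a) := by
  rw [hp.control_sub a b ha hab, ← abs_of_nonneg (sub_nonneg.2 hab)]
  refine intervalIntegral.norm_integral_le_of_norm_le_const fun τ hτ => ?_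
  rw [uIoc_of_le hab] at hτ
  exact hp.control_vel.bound τ (ha.trans hτ.1.le)

theorem tendsto_right_of_norm_sub_le {E : Type*} [NormedAddCommGroup E] {y : ℝ → E} {K t : ℝ}
    (hy : ∀ b, t ≤ b → ‖y b - y t‖ ≤ K * (b - t)) : Tendsto y (𝓝[>] t) (𝓝 (y t)) := by
  rw [tendsto_iff_norm_sub_tendsto_zero]
  refine squeeze_zero' (Eventually.of_forall fun _ => norm_nonneg _)
    (eventually_mem_nhdsWithin.mono fun b (hb : t < b) => hy b hb.le) ?_
  have : Tendsto (fun b => K * (b - t)) (𝓝 t) (𝓝 (K * (t - t))) :=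
    (continuous_const.mul (continuous_id.sub continuous_const)).tendsto t
  rw [sub_self, mul_zero] at this
  exact this.mono_left nhdsWithin_le_nhds

variable {n d m s : ℕ} {D : Data n d m s} {p : ControlProcess n d} {μ K : ℝ}

/-- The differential inclusion holds at every time for the right limits of `ẋ` and `a`. -/
theorem exists_right_values (hp : IsFeasible D p) (hK : TameReference p K)
    (hBV : BVBound p μ) (hC : IsClosed D.C)
    (hf : Continuous fun q : Vec n × Vec d => D.f q.1 q.2) (hν : ∀ i, Continuous (D.ν i))
    (hA : IsClosed D.A) {t : ℝ} (ht0 : 0 ≤ t) (htT : t < p.T) :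
    ∃ (v : Vec n) (a : Vec d), a ∈ D.A ∧ D.f (p.xe t) a - v ∈ normalCone D.C (p.xe t - p.ue t) ∧
      p.ue t ∈ D.U ∧ ∀ b, t < b → b ≤ p.T → ∀ τ ∈ Icc t b,
        ‖v - p.vxe τ‖ ≤ (eVariationOn p.vxe (Icc t b)).toReal ∧
        ‖a - p.ae τ‖ ≤ (eVariationOn p.ae (Icc t b)).toReal := by
  have evx : EqOn p.vxe p.vx (Icc 0 p.T) := fun τ hτ => if_pos hτ.2
  have ea : EqOn p.ae p.a (Icc 0 p.T) := fun τ hτ => by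
    rw [ControlProcess.ae, min_eq_left hτ.2]
  have bvx : BoundedVariationOn p.vxe (Icc 0 p.T) := by
    rw [BoundedVariationOn, eVariationOn.eq_of_eqOn evx]
    exact ne_top_of_le_ne_top ENNReal.ofReal_ne_top hBV.var_vx
  have ba : BoundedVariationOn p.ae (Icc 0 p.T) := by
    rw [BoundedVariationOn, eVariationOn.eq_of_eqOn ea]
    exact ne_top_of_le_ne_top ENNReal.ofReal_ne_top hBV.var_a
  obtain ⟨v, hv⟩ := bvx.exists_tendsto_right t
  obtain ⟨a, ha⟩ := ba.exists_tendsto_right t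
  have hmem : Icc 0 p.T ∩ Ioi t ∈ 𝓝[>] t := by
    filter_upwards [Ioo_mem_nhdsGT htT] with τ hτ
    exact ⟨⟨ht0.trans hτ.1.le, hτ.2.le⟩, hτ.1⟩
  have hle : 𝓝[>] t ≤ 𝓝[Icc 0 p.T ∩ Ioi t] t := by
    rw [nhdsWithin, nhdsWithin]
    exact le_inf inf_le_left (le_principal_iff.2 hmem)
  replace hv := hv.mono_left hle
  replace ha := ha.mono_left hle
  have hx := tendsto_right_of_norm_sub_le fun b hb => hK.norm_xe_sub_le ht0 hb
  have hu := tendsto_right_of_norm_sub_le fun b hb => hK.norm_ue_sub_le ht0 hb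
  -- The inclusions hold almost everywhere, hence at some time in every right neighbourhood of `t`.
  -- Together with closedness this suffices to pass to the right limit.
  have hgood : ∃ᶠ τ in 𝓝[>] t, p.ue τ ∈ D.U ∧ p.ae τ ∈ D.A ∧
      D.f (p.xe τ) (p.ae τ) - p.vxe τ ∈ normalCone D.C (p.xe τ - p.ue τ) := by
    have hall := (ae_restrict_iff' measurableSet_Icc).1
      ((hp.u_mem.and hp.a_mem).and hp.dynamics)
    rw [frequently_iff]
    intro W hW
    obtain ⟨c, hc, hsub⟩ := (mem_nhdsGT_iff_exists_Ioo_subset' htT).1 hW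
    have hpos : 0 < volume (Ioo t (min c p.T)) := by
      rw [Real.volume_Ioo]
      exact ENNReal.ofReal_pos.2 (sub_pos.2 (lt_min hc htT))
    obtain ⟨τ, hτ, hτ2⟩ := (frequently_ae_mem_iff.2 hpos.ne').and_eventually hall |>.exists
    have hτT : τ < p.T := hτ.2.trans_le (min_le_right _ _)
    obtain ⟨⟨h1, h2⟩, w, hw, hwe⟩ := hτ2 ⟨ht0.trans hτ.1.le, hτT.le⟩
    refine ⟨τ, hsub ⟨hτ.1, hτ.2.trans_le (min_le_left _ _)⟩, ?_⟩
    have e1 : p.xe τ = p.x τ := by rw [ControlProcess.xe, min_eq_left hτT.le]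
    have e2 : p.ue τ = p.u τ := by rw [ControlProcess.ue, min_eq_left hτT.le]
    have e3 : p.ae τ = p.a τ := by rw [ControlProcess.ae, min_eq_left hτT.le]
    have e4 : p.vxe τ = p.vx τ := if_pos hτT.le
    rw [e1, e2, e3, e4]
    refine ⟨h1, h2, ?_⟩
    have : D.f (p.x τ) (p.a τ) - p.vx τ = w := by
      rw [sub_eq_add_neg, hwe]; abel
    rwa [this]
  have hUc : IsClosed D.U :=
    isClosed_iInter fun i => isClosed_le (hν i) continuous_const
  refine ⟨v, a, hA.mem_of_frequently_of_tendsto (hgood.mono fun _ h => h.2.1) ha, ?_,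
    hUc.mem_of_frequently_of_tendsto (hgood.mono fun _ h => h.1) hu, fun b htb hbT τ hτ => ?_⟩
  · have hlim : Tendsto (fun τ => ((p.xe τ - p.ue τ : Vec n), D.f (p.xe τ) (p.ae τ) - p.vxe τ))
        (𝓝[>] t) (𝓝 (p.xe t - p.ue t, D.f (p.xe t) a - v)) :=
      (hx.sub hu).prodMk_nhds (((hf.tendsto (p.xe t, a)).comp (hx.prodMk_nhds ha)).sub hv)
    exact (isClosed_graph_normalCone hC).mem_of_frequently_of_tendsto
      (hgood.mono fun _ h => h.2.2) hlim
  · have hsub : Icc t b ⊆ Icc 0 p.T := Icc_subset_Icc ht0 hbT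
    have hev : ∀ᶠ σ in 𝓝[>] t, σ ∈ Icc t b := by
      filter_upwards [Ioo_mem_nhdsGT htb] with σ hσ using Ioo_subset_Icc_self hσ
    constructor
    · refine le_of_tendsto (hv.sub_const (p.vxe τ)).norm (hev.mono fun σ hσ => ?_)
      rw [← dist_eq_norm]
      exact (bvx.mono hsub).dist_le hσ hτ
    · refine le_of_tendsto (ha.sub_const (p.ae τ)).norm (hev.mono fun σ hσ => ?_)
      rw [← dist_eq_norm]
      exact (ba.mono hsub).dist_le hσ hτ

end

/-! ### Construction of a feasible discrete process -/

section

variable {n d m s : ℕ} {D : Data n d m s} {p : ControlProcess n d} {Lf Lν μ ε K : ℝ}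

/-- The right limits of `ẋ` and `a` at the points of a mesh. -/
theorem exists_mesh_values (hp : IsFeasible D p) (hK : TameReference p K)
    (hBV : BVBound p μ) (hC : IsClosed D.C)
    (hf : Continuous fun q : Vec n × Vec d => D.f q.1 q.2) (hν : ∀ i, Continuous (D.ν i))
    (hA : IsClosed D.A) {k : ℕ} {h : ℝ} (hh : 0 < h) (hkh : k * h = p.T) :
    ∃ (V : ℕ → Vec n) (a : ℕ → Vec d), ∀ j < k, a j ∈ D.A ∧
      D.f (p.xe (j * h)) (a j) - V j ∈ normalCone D.C (p.xe (j * h) - p.ue (j * h)) ∧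
      p.ue (j * h) ∈ D.U ∧ ∀ τ ∈ Icc ((j : ℝ) * h) ((j + 1 : ℕ) * h),
        ‖V j - p.vxe τ‖ ≤ cellVar p.vxe h j ∧ ‖a j - p.ae τ‖ ≤ cellVar p.ae h j := by
  -- The condition `j < k` is placed inside the existential so that `choose` yields sequences on all
  -- of `ℕ`, with dummy values from `k` on.
  have key : ∀ j : ℕ, ∃ (v : Vec n) (a : Vec d), j < k → a ∈ D.A ∧
      D.f (p.xe (j * h)) a - v ∈ normalCone D.C (p.xe (j * h) - p.ue (j * h)) ∧
      p.ue (j * h) ∈ D.U ∧ ∀ τ ∈ Icc ((j : ℝ) * h) ((j + 1 : ℕ) * h),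
        ‖v - p.vxe τ‖ ≤ cellVar p.vxe h j ∧ ‖a - p.ae τ‖ ≤ cellVar p.ae h j := by
    intro j
    by_cases hj : j < k
    · have hlt : (j : ℝ) * h < (j + 1 : ℕ) * h := by push_cast; linarith
      have hle : ((j + 1 : ℕ) : ℝ) * h ≤ p.T := by
        rw [← hkh]
        have : ((j + 1 : ℕ) : ℝ) ≤ k := by exact_mod_cast hj
        gcongr
      obtain ⟨v, a, h1, h2, h3, h4⟩ := exists_right_values hp hK hBV hC hf hν hA
        (by positivity : (0 : ℝ) ≤ j * h) (hlt.trans_le hle)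
      exact ⟨v, a, fun _ => ⟨h1, h2, h3, h4 _ hlt hle⟩⟩
    · exact ⟨0, 0, fun h => absurd h hj⟩
  choose V a hVa using key
  exact ⟨V, a, hVa⟩

/-- The Euler scheme with slopes `V` and controls `a`, corrected by the variation of `f`. -/
def eulerPath (D : Data n d m s) (p : ControlProcess n d) (h : ℝ) (V : ℕ → Vec n) (a : ℕ → Vec d) :
    ℕ → Vec n
  | 0 => D.x₀
  | j + 1 => eulerPath D p h V a j +
      h • (V j + (D.f (eulerPath D p h V a j) (a j) - D.f (p.xe (j * h)) (a j)))

/-- A sum of shifted nonnegative terms. -/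
theorem sum_range_pred_succ_le {w : ℕ → ℝ} (hw : ∀ j, 0 ≤ w j) (k : ℕ) :
    ∑ i ∈ Finset.range (k - 1), w (i + 1) ≤ ∑ i ∈ Finset.range k, w i := by
  cases k with
  | zero => simp
  | succ k =>
    rw [Finset.sum_range_succ', Nat.add_sub_cancel]
    linarith [hw 0]

-- The corrected Euler scheme has error of order `h` at the nodes, and `c` is chosen so that `Lf *
-- ‖e j‖ ≤ c * h`. The left sides of `h2` and `h3` are the resulting bounds for the L² errors of the
-- values and of the velocities.
set_option maxHeartbeats 1600000 in
theorem exists_feasible_of_small (hp : IsFeasible D p) (hK : TameReference p K)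
    (hBV : BVBound p μ) (hμ : 0 < μ) (hT : 0 < p.T) (hC : IsClosed D.C)
    (hf : Continuous fun q : Vec n × Vec d => D.f q.1 q.2)
    (hfL : D.PerturbationAssumption Lf p.u p.T) (hν : D.ControlConstraintAssumption Lν)
    (hA : IsClosed D.A) {k : ℕ} (hk : 0 < k) {c : ℝ} (hc : c = Lf * (Real.exp (Lf * p.T) * μ))
    (hε : 0 < ε) (h1 : p.T / k * c ≤ 1)
    (h2 : p.T / k * (2 * (Real.exp (Lf * p.T) * μ + K) ^ 2 * p.T * p.T + μ ^ 2) ≤ ε / 2)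
    (h3 : p.T / k * ((2 * μ + c * p.T) * (2 * (c * p.T) + 3 * μ)) ≤ ε / 2) :
    ∃ z : DiscreteProcess n d k, z.Feasible D p Lf Lν μ ε := by
  have hkR : (0 : ℝ) < k := by exact_mod_cast hk
  have hL := hfL.pos
  set h := p.T / k with hh_def
  have hh : 0 < h := div_pos hT hkR
  have hkh : (k : ℝ) * h = p.T := by rw [hh_def]; field_simp
  have hhT : h ≤ p.T := by
    rw [← hkh]
    have : (1 : ℝ) ≤ k := by exact_mod_cast hk
    nlinarith
  set M := Real.exp (Lf * p.T) with hM
  have hM1 : 1 ≤ M := Real.one_le_exp (by positivity)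
  have hc0 : 0 ≤ c := by rw [hc]; positivity
  have hν' : ∀ i, Continuous (D.ν i) := fun i => (hν.smooth i).continuous
  obtain ⟨V, a, hVa⟩ := exists_mesh_values hp hK hBV hC hf hν' hA hh hkh
  -- variations on the cells
  have vx : eVariationOn p.vxe (Icc 0 (k * h)) ≤ ENNReal.ofReal μ := by
    rw [hkh, eVariationOn.eq_of_eqOn (show EqOn p.vxe p.vx (Icc 0 p.T) from fun τ hτ => if_pos hτ.2)]
    exact hBV.var_vx
  have vu : eVariationOn p.vue (Icc 0 (k * h)) ≤ ENNReal.ofReal μ := by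
    rw [hkh, eVariationOn.eq_of_eqOn (show EqOn p.vue p.vu (Icc 0 p.T) from fun τ hτ => if_pos hτ.2)]
    exact hBV.var_vu
  have va : eVariationOn p.ae (Icc 0 (k * h)) ≤ ENNReal.ofReal μ := by
    rw [hkh, eVariationOn.eq_of_eqOn (f' := p.a) fun τ hτ => by
      rw [ControlProcess.ae, min_eq_left hτ.2]]
    exact hBV.var_a
  have sx := sum_cellVar_le hh.le hμ.le vx
  have su := sum_cellVar_le hh.le hμ.le vu
  have sa := sum_cellVar_le hh.le hμ.le va
  have nx : ∀ j, 0 ≤ cellVar p.vxe h j := fun j => cellVar_nonneg j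
  have nu : ∀ j, 0 ≤ cellVar p.vue h j := fun j => cellVar_nonneg j
  have na : ∀ j, 0 ≤ cellVar p.ae h j := fun j => cellVar_nonneg j
  have cx := fun j hj => cellVar_le (j := j) hh.le hμ.le vx hj
  have cu := fun j hj => cellVar_le (j := j) hh.le hμ.le vu hj
  have ca := fun j hj => cellVar_le (j := j) hh.le hμ.le va hj
  have hcell : ∀ j : ℕ, (j : ℝ) * h ≤ (j + 1 : ℕ) * h := fun j => by push_cast; linarith
  have hlen : ∀ j : ℕ, ((j + 1 : ℕ) : ℝ) * h - j * h = h := fun j => by push_cast; ring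
  -- the discrete trajectory
  set X := eulerPath D p h V a with hX
  -- The control absorbs the state error, so `X j - U j` equals the reference difference at the node
  -- and the base point of the normal cone does not move.
  set U : ℕ → Vec n := fun j => p.ue (j * h) + (X j - p.xe (j * h)) with hU
  set e : ℕ → Vec n := fun j => X j - p.xe (j * h) with he
  have hXs : ∀ j, X (j + 1) = X j + h • (V j + (D.f (X j) (a j) - D.f (p.xe (j * h)) (a j))) :=
    fun j => rfl
  have hfd : ∀ j, ‖D.f (X j) (a j) - D.f (p.xe (j * h)) (a j)‖ ≤ Lf * ‖e j‖ := fun j => by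
    have := hfL.lipschitz (X j) (p.xe (j * h)) (a j) (a j)
    rwa [sub_self, norm_zero, add_zero] at this
  have hmx : ∀ j < k, ‖h⁻¹ • (p.xe ((j + 1 : ℕ) * h) - p.xe (j * h)) - V j‖ ≤ cellVar p.vxe h j :=
    fun j hj => hK.state_vel.norm_mean_sub_le hh hK.state_sub fun τ hτ => by
      rw [norm_sub_rev]; exact ((hVa j hj).2.2.2 τ hτ).1
  have hed : ∀ j, h⁻¹ • (e (j + 1) - e j) = (D.f (X j) (a j) - D.f (p.xe (j * h)) (a j))
      - (h⁻¹ • (p.xe ((j + 1 : ℕ) * h) - p.xe (j * h)) - V j) := fun j => by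
    have : e (j + 1) - e j = (X (j + 1) - X j) - (p.xe ((j + 1 : ℕ) * h) - p.xe (j * h)) := by
      simp only [he]; abel
    rw [this, hXs, add_sub_cancel_left, smul_sub, inv_smul_smul₀ hh.ne']
    abel
  have hed' : ∀ j < k, ‖h⁻¹ • (e (j + 1) - e j)‖ ≤ Lf * ‖e j‖ + cellVar p.vxe h j := fun j hj => by
    rw [hed]
    exact (norm_sub_le _ _).trans (add_le_add (hfd j) (hmx j hj))
  have he0 : e 0 = 0 := by
    simp only [he, hX, eulerPath, Nat.cast_zero, zero_mul, ControlProcess.xe, min_eq_left hT.le,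
      hp.initial, sub_self]
  -- Gronwall with the cell variations of the state velocity as local errors: they sum to at most
  -- `μ`, which leaves one factor `h`.
  have hebound : ∀ j ≤ k, ‖e j‖ ≤ M * μ * h := by
    intro j hj
    have hg := discrete_gronwall hh.le hL.le nx he0 (fun j hj => by
      have := hed' j hj
      rw [norm_smul, norm_inv, Real.norm_of_nonneg hh.le, inv_mul_le_iff₀ hh] at this
      exact this) j hj
    have hjk : (j : ℝ) ≤ k := by exact_mod_cast hj
    have hs : ∑ i ∈ Finset.range j, cellVar p.vxe h i ≤ μ :=
      (Finset.sum_le_sum_of_subset_of_nonneg (Finset.range_mono hj) fun i _ _ => nx i).trans sx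
    have hexp : Real.exp (Lf * (j * h)) ≤ M := by
      rw [hM, ← hkh]
      gcongr
    calc ‖e j‖ ≤ _ := hg
      _ ≤ M * (h * μ) := by
        have : 0 ≤ h * ∑ i ∈ Finset.range j, cellVar p.vxe h i :=
          mul_nonneg hh.le (Finset.sum_nonneg fun i _ => nx i)
        gcongr
      _ = M * μ * h := by ring
  have hLe : ∀ j ≤ k, Lf * ‖e j‖ ≤ c * h := fun j hj => by
    rw [hc]
    calc _ ≤ Lf * (M * μ * h) := by gcongr; exact hebound j hj
      _ = _ := by ring
  have hed'' : ∀ j < k, ‖h⁻¹ • (e (j + 1) - e j)‖ ≤ c * h + cellVar p.vxe h j := fun j hj =>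
    (hed' j hj).trans (add_le_add_left (hLe j hj.le) _)
  have hUd : ∀ j, h⁻¹ • (U (j + 1) - U j) = h⁻¹ • (e (j + 1) - e j)
      + h⁻¹ • (p.ue ((j + 1 : ℕ) * h) - p.ue (j * h)) := fun j => by
    rw [← smul_add]; congr 1; simp only [hU, he]; abel
  have hchT : c * h ≤ c * p.T := by gcongr
  -- The tolerances `delta` and `muX` both dominate the error; the powers of `1/2` and the factor `2
  -- * Lf + 1` are slack.
  have hdelta : M * μ * h ≤ delta Lf μ p.T k := by
    have h0 : 0 ≤ p.T * 2⁻¹ ^ k := by positivity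
    calc M * μ * h = M * 1 * (h * μ + 0) := by ring
      _ ≤ M * (2 * Lf + 1) * (h * μ + p.T * 2⁻¹ ^ k) := by gcongr; linarith
      _ = delta Lf μ p.T k := rfl
  have hmuX : M * μ * h ≤ muX Lf μ p.T k := by
    have h0 : 0 ≤ p.T * 2⁻¹ ^ k := by positivity
    have h4 : M ≤ M * (1 + Lf * h) + 1 := by nlinarith [mul_pos hL hh]
    calc M * μ * h = (h * μ + 0) * 1 * M := by ring
      _ ≤ (h * μ + p.T * 2⁻¹ ^ k) * (2 * Lf + 1) * (M * (1 + Lf * h) + 1) := by gcongr; linarith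
      _ = muX Lf μ p.T k := rfl
  have hmuX0 : 0 ≤ muX Lf μ p.T k := le_trans (by positivity) hmuX
  have htilde : 3 * μ + 1 + 2 * (c * p.T) ≤ muTilde Lf μ p.T := by
    refine le_trans ?_ (le_max_left _ _)
    have h5 : c * p.T ≤ Lf * p.T * μ * M * (2 * Lf + 1) := by
      rw [hc]
      have : 0 ≤ Lf * p.T * μ * M := by positivity
      nlinarith
    have h6 : 0 ≤ c * p.T := by positivity
    have h7 : 0 ≤ Lf * μ := by positivity
    rw [← hM]
    nlinarith
  have hT1 : c * h ≤ 1 := by rw [mul_comm]; exact h1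
  have hcT : 0 ≤ c * p.T := by positivity
  have hue : ∀ t ≤ p.T, p.ue t = p.u t := fun t ht => by rw [ControlProcess.ue, min_eq_left ht]
  have hquot : ∀ j < k, ‖h⁻¹ • (p.ue ((j + 1 : ℕ) * h) - p.ue (j * h))‖ ≤ μ →
      ‖h⁻¹ • (U (j + 1) - U j)‖ ≤ muTilde Lf μ p.T + 1 := fun j hj hb => by
    rw [hUd]
    have := norm_add_le (h⁻¹ • (e (j + 1) - e j)) (h⁻¹ • (p.ue ((j + 1 : ℕ) * h) - p.ue (j * h)))
    linarith [hed'' j hj, cx j hj]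
  let z : DiscreteProcess n d k := ⟨fun i => X i, fun i => U i, fun i => a i, p.T⟩
  -- `uAt` reduces its index modulo `k + 1`, hence the restriction `j ≤ k`.
  have hzu : ∀ j ≤ k, z.uAt j = U j := fun j hj => by
    simp only [DiscreteProcess.uAt, z, Fin.val_ofNat, Nat.mod_eq_of_lt (Nat.lt_succ_of_le hj)]
  refine ⟨z,
    { time_pos := hT
      dynamics := fun j => ?_
      initial_x := rfl
      initial_u := ?_
      endpoint := ?_
      endtime := ?_
      time_local := ?_
      u_mem := fun j i => ?_
      a_mem := fun j => (hVa j j.2).1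
      local_values := ?_
      local_velocities := ?_
      end_quots := ?_
      second_var := ?_ }⟩
  -- The normal vector is the one of the reference at the node; the correction term of the scheme
  -- replaces `f` at the reference state by `f` at `X j`.
  · refine ⟨_, ⟨D.f (p.xe (j * h)) (a j) - V j, ?_, rfl⟩, ?_⟩
    · have : z.x j.castSucc - z.u j.castSucc = p.xe (j * h) - p.ue (j * h) := by
        simp only [z, hU, Fin.val_castSucc]; abel
      rw [this]
      exact (hVa j j.2).2.1
    · have hw : V j + (D.f (X j) (a j) - D.f (p.xe (j * h)) (a j))
          = -(D.f (p.xe (j * h)) (a j) - V j - D.f (X j) (a j)) := by abel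
      show X (j + 1) = X j - h • (D.f (p.xe (j * h)) (a j) - V j - D.f (X j) (a j))
      rw [hXs, hw, smul_neg, ← sub_eq_add_neg]
  · show U 0 = p.u 0
    have : U 0 = p.ue ((0 : ℕ) * h) + e 0 := rfl
    rw [this, he0, add_zero, Nat.cast_zero, zero_mul, hue 0 hT.le]
  · refine ⟨p.x p.T, hp.endpoint, e k, ?_, ?_⟩
    · rw [mem_closedBall_zero_iff]
      exact (hebound k le_rfl).trans hmuX
    · show p.x p.T + e k = X k
      simp only [he, hkh, ControlProcess.xe, min_self]
      abel
  · refine ⟨p.T, hp.endtime, 0, ?_, add_zero _⟩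
    exact Metric.mem_closedBall_self hmuX0
  · show |p.T - p.T| ≤ ε
    rw [sub_self, abs_zero]; exact hε.le
  · show D.ν i (U j) ≤ _
    have hUi : D.ν i (p.ue (j * h)) ≤ 0 := by
      have := (hVa j j.2).2.2.1
      exact mem_iInter.1 this i
    have hl := hν.lipschitz i (p.ue (j * h)) (U j)
    have hUe : U j - p.ue (j * h) = e j := by simp only [hU, he]; abel
    rw [hUe] at hl
    have := (le_abs_self _).trans hl
    have h8 : Lν * ‖e j‖ ≤ Lν * delta Lf μ p.T k :=
      mul_le_mul_of_nonneg_left ((hebound j j.2.le).trans hdelta) hν.pos.le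
    linarith
  · have hK0 : 0 ≤ K := (norm_nonneg _).trans (hK.state.bound 0 le_rfl)
    -- Node error plus the drift of the `K`-Lipschitz reference over one cell.
    set R := (M * μ + K) * h with hR
    have hterm : ∀ j : Fin k, (∫ τ in (z.t j)..(z.t (j + 1)), (‖z.x j.castSucc - p.xe τ‖ ^ 2
        + ‖z.u j.castSucc - p.ue τ‖ ^ 2 + ‖z.a j - p.ae τ‖ ^ 2))
        ≤ (fun i : ℕ => (2 * R ^ 2 + μ * cellVar p.ae h i) * h) j := by
      intro j
      have hj := hebound j j.2.le
      refine (le_abs_self _).trans ?_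
      have hb := intervalIntegral.norm_integral_le_of_norm_le_const (a := z.t j)
        (b := z.t (j + 1)) (f := fun τ => ‖z.x j.castSucc - p.xe τ‖ ^ 2
        + ‖z.u j.castSucc - p.ue τ‖ ^ 2 + ‖z.a j - p.ae τ‖ ^ 2)
        (C := 2 * R ^ 2 + μ * cellVar p.ae h j) fun τ hτ => ?_
      · rw [show z.t (j + 1) - z.t j = h from hlen j, abs_of_pos hh] at hb
        exact hb
      · rw [uIoc_of_le (show z.t j ≤ z.t (j + 1) from hcell j)] at hτ
        have hτ' : τ ∈ Icc ((j : ℝ) * h) ((j + 1 : ℕ) * h) := Ioc_subset_Icc_self hτ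
        have hτl : τ - j * h ≤ h := by have := hτ'.2; have := hlen j; linarith
        have hj0 : (0 : ℝ) ≤ j * h := by positivity
        have b1 : ‖z.x j.castSucc - p.xe τ‖ ≤ R := by
          have : z.x j.castSucc - p.xe τ = e j - (p.xe τ - p.xe (j * h)) := by
            simp only [z, he, Fin.val_castSucc]; abel
          rw [this]
          have t1 := norm_sub_le (e j) (p.xe τ - p.xe (j * h))
          have t2 := hK.norm_xe_sub_le hj0 hτ'.1
          have t3 : K * (τ - j * h) ≤ K * h := by gcongr
          rw [hR]; linarith
        have b2 : ‖z.u j.castSucc - p.ue τ‖ ≤ R := by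
          have : z.u j.castSucc - p.ue τ = e j - (p.ue τ - p.ue (j * h)) := by
            simp only [z, he, hU, Fin.val_castSucc]; abel
          rw [this]
          have t1 := norm_sub_le (e j) (p.ue τ - p.ue (j * h))
          have t2 := hK.norm_ue_sub_le hj0 hτ'.1
          have t3 : K * (τ - j * h) ≤ K * h := by gcongr
          rw [hR]; linarith
        have b3 : ‖z.a j - p.ae τ‖ ≤ cellVar p.ae h j := ((hVa j j.2).2.2.2 τ hτ').2
        have q1 := pow_le_pow_left₀ (norm_nonneg _) b1 2
        have q2 := pow_le_pow_left₀ (norm_nonneg _) b2 2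
        have q3 := pow_le_pow_left₀ (norm_nonneg _) b3 2
        -- One factor is bounded by `μ`, so that the other can be summed over the cells.
        have q4 : cellVar p.ae h j ^ 2 ≤ μ * cellVar p.ae h j := by
          rw [pow_two]; exact mul_le_mul_of_nonneg_right (ca j j.2) (na j)
        rw [Real.norm_of_nonneg (by positivity)]
        linarith
    refine (Finset.sum_le_sum fun j _ => hterm j).trans ?_
    rw [Fin.sum_univ_eq_sum_range (fun i : ℕ => (2 * R ^ 2 + μ * cellVar p.ae h i) * h) k,
      ← Finset.sum_mul, Finset.sum_add_distrib, Finset.sum_const,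
      Finset.card_range, nsmul_eq_mul, ← Finset.mul_sum]
    refine le_trans ?_ h2
    have w1 : μ * ∑ i ∈ Finset.range k, cellVar p.ae h i ≤ μ ^ 2 := by
      rw [pow_two]; gcongr
    have w2 : (k : ℝ) * (2 * R ^ 2) ≤ 2 * (M * μ + K) ^ 2 * p.T * p.T := by
      have : (k : ℝ) * (2 * R ^ 2) = 2 * (M * μ + K) ^ 2 * (k * h) * h := by rw [hR]; ring
      rw [this, hkh]
      gcongr
    nlinarith
  · have hterm : ∀ j : Fin k, (∫ τ in (z.t j)..(z.t (j + 1)), (‖z.dx j - p.vxe τ‖ ^ 2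
        + ‖z.du j - p.vue τ‖ ^ 2)) ≤ (fun i : ℕ => ((2 * μ + c * p.T) *
          (2 * (c * h) + 2 * cellVar p.vxe h i + cellVar p.vue h i)) * h) j := by
      intro j
      refine (le_abs_self _).trans ?_
      have hb := intervalIntegral.norm_integral_le_of_norm_le_const (a := z.t j)
        (b := z.t (j + 1)) (f := fun τ => ‖z.dx j - p.vxe τ‖ ^ 2 + ‖z.du j - p.vue τ‖ ^ 2)
        (C := (2 * μ + c * p.T) *
          (2 * (c * h) + 2 * cellVar p.vxe h j + cellVar p.vue h j)) fun τ hτ => ?_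
      · rw [show z.t (j + 1) - z.t j = h from hlen j, abs_of_pos hh] at hb
        exact hb
      · rw [uIoc_of_le (show z.t j ≤ z.t (j + 1) from hcell j)] at hτ
        have hτ' : τ ∈ Icc ((j : ℝ) * h) ((j + 1 : ℕ) * h) := Ioc_subset_Icc_self hτ
        have b1 : ‖z.dx j - p.vxe τ‖ ≤ c * h + cellVar p.vxe h j := by
          have : z.dx j - p.vxe τ = (D.f (X j) (a j) - D.f (p.xe (j * h)) (a j))
              + (V j - p.vxe τ) := by
            show h⁻¹ • (X (j + 1) - X j) - p.vxe τ = _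
            rw [hXs, add_sub_cancel_left, inv_smul_smul₀ hh.ne']
            abel
          rw [this]
          exact (norm_add_le _ _).trans (add_le_add ((hfd j).trans (hLe j j.2.le))
            ((hVa j j.2).2.2.2 τ hτ').1)
        have b2 : ‖z.du j - p.vue τ‖ ≤ c * h + cellVar p.vxe h j + cellVar p.vue h j := by
          have : z.du j - p.vue τ = h⁻¹ • (e (j + 1) - e j)
              + (h⁻¹ • (p.ue (((j : ℕ) + 1 : ℕ) * h) - p.ue (j * h)) - p.vue τ) := by
            show h⁻¹ • (U (j + 1) - U j) - p.vue τ = _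
            rw [hUd, add_sub_assoc]
          rw [this]
          refine (norm_add_le _ _).trans (add_le_add (hed'' j j.2) ?_)
          exact hK.control_vel.norm_mean_sub_le hh hK.control_sub fun σ hσ =>
            norm_sub_le_cellVar hh.le vu j.2 hσ hτ'
        have g1 := cx j j.2
        have g2 := cu j j.2
        have g3 := nx j
        have g4 := nu j
        have g5 : 0 ≤ c * h := by positivity
        -- Each velocity error is at most `2 * μ + c * p.T`. Using this for one factor makes the
        -- bound linear in the cell variations, which sum to at most `3 * μ`.
        have q1 : ‖z.dx j - p.vxe τ‖ ^ 2 ≤ (2 * μ + c * p.T) * (c * h + cellVar p.vxe h j) := by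
          rw [pow_two]
          exact mul_le_mul (b1.trans (by linarith)) b1 (norm_nonneg _) (by positivity)
        have q2 : ‖z.du j - p.vue τ‖ ^ 2 ≤
            (2 * μ + c * p.T) * (c * h + cellVar p.vxe h j + cellVar p.vue h j) := by
          rw [pow_two]
          exact mul_le_mul (b2.trans (by linarith)) b2 (norm_nonneg _) (by positivity)
        rw [Real.norm_of_nonneg (by positivity)]
        linarith
    refine (Finset.sum_le_sum fun j _ => hterm j).trans ?_
    rw [Fin.sum_univ_eq_sum_range (fun i : ℕ => ((2 * μ + c * p.T) *
      (2 * (c * h) + 2 * cellVar p.vxe h i + cellVar p.vue h i)) * h) k,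
      ← Finset.sum_mul, ← Finset.mul_sum, Finset.sum_add_distrib, Finset.sum_add_distrib,
      Finset.sum_const, Finset.card_range, nsmul_eq_mul, ← Finset.mul_sum]
    refine le_trans ?_ h3
    rw [mul_comm]
    have w1 : (k : ℝ) * (2 * (c * h)) = 2 * (c * p.T) := by rw [← hkh]; ring
    rw [w1]
    refine mul_le_mul_of_nonneg_left (mul_le_mul_of_nonneg_left ?_ (by positivity)) hh.le
    linarith
  · refine max_le ?_ ?_
    · show ‖h⁻¹ • (z.uAt 1 - z.uAt 0)‖ ≤ _
      rw [hzu 1 hk, hzu 0 hk.le]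
      refine hquot 0 hk ?_
      rw [zero_add, Nat.cast_one, one_mul, Nat.cast_zero, zero_mul, hue h hhT, hue 0 hT.le]
      exact hBV.first_quot k hk
    · show ‖h⁻¹ • (z.uAt k - z.uAt (k - 1))‖ ≤ _
      rw [hzu k le_rfl, hzu (k - 1) (by omega)]
      have hq := hquot (k - 1) (by omega)
      have hk1 : k - 1 + 1 = k := by omega
      have hk2 : ((k - 1 : ℕ) : ℝ) * h = p.T - h := by
        rw [Nat.cast_sub hk, Nat.cast_one, sub_mul, hkh, one_mul]
      rw [hk1, hkh, hk2, hue _ le_rfl, hue _ (by linarith)] at hq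
      exact hq (hBV.last_quot k hk)
  · show ∑ j ∈ Finset.Ico 1 k, ‖h⁻¹ • (z.uAt (j + 1) - (2 : ℝ) • z.uAt j + z.uAt (j - 1))‖ ≤ _
    rw [Finset.sum_Ico_eq_sum_range]
    -- A second difference of `U` splits into two slopes of `e` and a second difference of the
    -- reference control. Summation gives at most `2 * (c * p.T) + 2 * μ + μ`, which `htilde`
    -- covers.
    have hterm : ∀ i ∈ Finset.range (k - 1),
        ‖h⁻¹ • (z.uAt (1 + i + 1) - (2 : ℝ) • z.uAt (1 + i) + z.uAt (1 + i - 1))‖ ≤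
        (c * h + cellVar p.vxe h (i + 1)) + (c * h + cellVar p.vxe h i)
        + h⁻¹ * ‖(p.ue ((i + 1 + 1 : ℕ) * h) - p.ue ((i + 1 : ℕ) * h))
          - (p.ue ((i + 1 : ℕ) * h) - p.ue (i * h))‖ := by
      intro i hi
      rw [Finset.mem_range] at hi
      rw [add_comm 1 i, Nat.add_sub_cancel, hzu _ (by omega), hzu _ (by omega), hzu _ (by omega)]
      have : h⁻¹ • (U (i + 1 + 1) - (2 : ℝ) • U (i + 1) + U i) =
          h⁻¹ • (e (i + 1 + 1) - e (i + 1)) - h⁻¹ • (e (i + 1) - e i)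
          + h⁻¹ • ((p.ue ((i + 1 + 1 : ℕ) * h) - p.ue ((i + 1 : ℕ) * h))
          - (p.ue ((i + 1 : ℕ) * h) - p.ue (i * h))) := by
        rw [← smul_sub, ← smul_add]
        congr 1
        simp only [hU, he, two_smul]
        abel
      rw [this]
      refine (norm_add_le _ _).trans (add_le_add ((norm_sub_le _ _).trans
        (add_le_add (hed'' _ (by omega)) (hed'' _ (by omega)))) ?_)
      rw [norm_smul, norm_inv, Real.norm_of_nonneg hh.le]
    refine (Finset.sum_le_sum hterm).trans ?_
    simp only [Finset.sum_add_distrib, ← Finset.mul_sum, Finset.sum_const, Finset.card_range,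
      nsmul_eq_mul]
    have w1 := (sum_range_pred_succ_le nx k).trans sx
    have w2 : ∑ i ∈ Finset.range (k - 1), cellVar p.vxe h i ≤ μ :=
      (Finset.sum_le_sum_of_subset_of_nonneg (Finset.range_mono (Nat.sub_le k 1))
        fun i _ _ => nx i).trans sx
    have w3 := hK.control_vel.sum_norm_second_difference_le hk hh hμ.le vu hK.control_sub
    rw [← inv_mul_le_iff₀ hh] at w3
    have w4 : ((k - 1 : ℕ) : ℝ) * (c * h) ≤ c * p.T := by
      rw [← hkh]
      have : ((k - 1 : ℕ) : ℝ) ≤ k := by exact_mod_cast Nat.sub_le k 1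
      calc ((k - 1 : ℕ) : ℝ) * (c * h) ≤ k * (c * h) := by gcongr
        _ = c * (k * h) := by ring
    linarith

/-- The discrete problems are feasible on all sufficiently fine meshes. -/
theorem eventually_exists_feasible (hp : IsFeasible D p) (hK : TameReference p K)
    (hBV : BVBound p μ) (hμ : 0 < μ) (hT : 0 < p.T) (hC : IsClosed D.C)
    (hf : Continuous fun q : Vec n × Vec d => D.f q.1 q.2)
    (hfL : D.PerturbationAssumption Lf p.u p.T) (hν : D.ControlConstraintAssumption Lν)
    (hA : IsClosed D.A) (hε : 0 < ε) :
    ∀ᶠ k : ℕ in atTop, ∃ z : DiscreteProcess n d k, z.Feasible D p Lf Lν μ ε := by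
  have hlim : ∀ b r : ℝ, 0 < r → ∀ᶠ k : ℕ in atTop, p.T / k * b ≤ r := fun b r hr => by
    have : Tendsto (fun k : ℕ => p.T / k * b) atTop (𝓝 (0 * b)) :=
      (tendsto_const_div_atTop_nhds_zero_nat p.T).mul_const b
    rw [zero_mul] at this
    exact (this.eventually (gt_mem_nhds hr)).mono fun _ h => h.le
  filter_upwards [eventually_gt_atTop 0, hlim _ 1 one_pos, hlim _ (ε / 2) (by positivity),
    hlim _ (ε / 2) (by positivity)] with k hk h1 h2 h3
  exact exists_feasible_of_small hp hK hBV hμ hT hC hf hfL hν hA hk rfl hε h1 h2 h3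

end

/-! ### Localization of the endpoint constraints and conclusion -/

section

variable {n d m s : ℕ} {D : Data n d m s} {p : ControlProcess n d} {Lf Lν μ ε K : ℝ}

theorem Data.PerturbationAssumption.continuous {u : ℝ → Vec n} {T : ℝ}
    (hf : D.PerturbationAssumption Lf u T) :
    Continuous fun q : Vec n × Vec d => D.f q.1 q.2 := by
  refine (LipschitzWith.of_dist_le_mul (K := ⟨2 * Lf, by linarith [hf.pos]⟩)
    fun q r => ?_).continuous
  rw [dist_eq_norm, dist_eq_norm]
  have h1 := norm_fst_le (q - r)
  have h2 := norm_snd_le (q - r)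
  have h3 := hf.lipschitz q.1 r.1 q.2 r.2
  rw [Prod.fst_sub] at h1
  rw [Prod.snd_sub] at h2
  have h4 : Lf * (‖q.1 - r.1‖ + ‖q.2 - r.2‖) ≤ Lf * (‖q - r‖ + ‖q - r‖) :=
    mul_le_mul_of_nonneg_left (add_le_add h1 h2) hf.pos.le
  show _ ≤ 2 * Lf * ‖q - r‖
  linarith

theorem Data.ConstraintAssumption.isClosed_C (hg : D.ConstraintAssumption) : IsClosed D.C :=
  isClosed_iInter fun i => isClosed_le continuous_const (hg.smooth i).continuous

theorem tendsto_muX (Lf μ T : ℝ) : Tendsto (muX Lf μ T) atTop (𝓝 0) := by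
  have h1 : Tendsto (fun k : ℕ => T / k) atTop (𝓝 0) := tendsto_const_div_atTop_nhds_zero_nat T
  have h2 : Tendsto (fun k : ℕ => (2⁻¹ : ℝ) ^ k) atTop (𝓝 0) :=
    tendsto_pow_atTop_nhds_zero_of_lt_one (by norm_num) (by norm_num)
  have h3 := (((h1.mul_const μ).add (h2.const_mul T)).mul_const (2 * Lf + 1)).mul
    ((((h1.const_mul Lf).const_add 1).const_mul (Real.exp (Lf * T))).add_const 1)
  simp only [zero_mul, mul_zero, add_zero] at h3
  exact h3

/-- A product that is closed around a point has locally closed factors there. -/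
theorem ClosedAround.exists_closed_factors {X Y : Type*} [PseudoMetricSpace X]
    [PseudoMetricSpace Y] {S : Set X} {S' : Set Y} {x : X} {y : Y} (h : ClosedAround (S ×ˢ S') (x, y))
    (hx : x ∈ S) (hy : y ∈ S') : ∃ r > 0, IsClosed (S ∩ Metric.closedBall x r) ∧
      IsClosed (S' ∩ Metric.closedBall y r) := by
  obtain ⟨V, hV, -, hcl⟩ := h
  obtain ⟨r, hr, hsub⟩ := Metric.nhds_basis_closedBall.mem_iff.1 hV
  rw [← closedBall_prod_same] at hsub
  have hyr : y ∈ Metric.closedBall y r := Metric.mem_closedBall_self hr.le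
  have hxr : x ∈ Metric.closedBall x r := Metric.mem_closedBall_self hr.le
  refine ⟨r, hr, ?_, ?_⟩
  -- Since `y ∈ S'`, the slice of the product at height `y` is `S`; a ball inside `V` makes it a
  -- closed slice near `x`.
  · have heq : S ∩ Metric.closedBall x r
        = (fun q => (q, y)) ⁻¹' (S ×ˢ S' ∩ V) ∩ Metric.closedBall x r := by
      ext q
      exact ⟨fun hq => ⟨⟨⟨hq.1, hy⟩, hsub ⟨hq.2, hyr⟩⟩, hq.2⟩, fun hq => ⟨hq.1.1.1, hq.2⟩⟩
    rw [heq]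
    exact (hcl.preimage (by fun_prop)).inter Metric.isClosed_closedBall
  · have heq : S' ∩ Metric.closedBall y r
        = (fun q => (x, q)) ⁻¹' (S ×ˢ S' ∩ V) ∩ Metric.closedBall y r := by
      ext q
      exact ⟨fun hq => ⟨⟨⟨hx, hq.1⟩, hsub ⟨hxr, hq.2⟩⟩, hq.2⟩, fun hq => ⟨hq.1.1.2, hq.2⟩⟩
    rw [heq]
    exact (hcl.preimage (by fun_prop)).inter Metric.isClosed_closedBall

/-- The summand of `y` lying in `S` is within `ρ + δ` of `x`, so the same decomposition works after
intersecting with the ball. -/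
theorem mem_inter_closedBall_add {E : Type*} [SeminormedAddCommGroup E] {S : Set E} {x y : E}
    {δ r ρ : ℝ} (hy : y ∈ S + Metric.closedBall 0 δ) (hxy : ‖y - x‖ ≤ ρ) (hr : ρ + δ ≤ r) :
    y ∈ S ∩ Metric.closedBall x r + Metric.closedBall 0 δ := by
  obtain ⟨w, hw, b, hb, rfl⟩ := hy
  refine ⟨w, ⟨hw, ?_⟩, b, hb, rfl⟩
  rw [mem_closedBall_zero_iff] at hb
  rw [mem_closedBall_iff_norm]
  have h1 : w - x = (w + b - x) - b := by abel
  rw [h1]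
  exact (norm_sub_le _ _).trans (by simp only at hxy; linarith)

/-- Endpoints of feasible discrete processes are close to the reference endpoint. -/
theorem norm_endpoint_sub_le (hK : TameReference p K) (hx0 : p.x 0 = D.x₀) {k : ℕ} (hk : 0 < k)
    {z : DiscreteProcess n d k} (hz : z.Feasible D p Lf Lν μ ε) {lam : ℝ} (hlam : 0 < lam) :
    ‖z.x (Fin.last k) - p.x p.T‖ ≤ lam * (p.T + ε) + lam⁻¹ * (ε / 2) + K * ε := by
  have hT := hz.time_local
  have hT' := abs_le.1 hT
  have hK0 : 0 ≤ K := (norm_nonneg _).trans (hK.state.bound 0 le_rfl)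
  have h1 := (dist_reference_le hK hx0 hk hz hlam (Fin.last k)).1
  have hkT : z.t (Fin.last k : ℕ) = z.T := by
    have : (k : ℝ) ≠ 0 := by exact_mod_cast hk.ne'
    simp only [DiscreteProcess.t, DiscreteProcess.h, Fin.val_last]
    field_simp
  rw [hkT] at h1
  have h2 : ‖p.xe z.T - p.xe p.T‖ ≤ K * ε := by
    rcases le_total p.T z.T with h | h
    · refine (hK.norm_xe_sub_le hK.time_nonneg h).trans ?_
      gcongr
      linarith
    · rw [norm_sub_rev]
      refine (hK.norm_xe_sub_le hz.time_pos.le h).trans ?_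
      gcongr
      linarith
  have h3 : p.xe p.T = p.x p.T := by rw [ControlProcess.xe, min_self]
  rw [h3] at h2
  have h4 : z.x (Fin.last k) - p.x p.T
      = (z.x (Fin.last k) - p.xe z.T) + (p.xe z.T - p.x p.T) := by abel
  have h5 : lam * z.T ≤ lam * (p.T + ε) := by gcongr; linarith
  rw [h4]
  refine (norm_add_le _ _).trans ?_
  linarith

end

end FreeSweeping

end

open FreeSweeping in
theorem proposition5p1 {n d m s : ℕ} (D : Data n d m s) (p : ControlProcess n d) (Lf Lν μ : ℝ)
    (hf : D.PerturbationAssumption Lf p.u p.T)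
    (hg : D.ConstraintAssumption)
    (hν : D.ControlConstraintAssumption Lν)
    (hA : D.ControlSetAssumption)
    (hcost : D.CostAssumption)
    (hp : IsFeasible D p)
    (hT : 0 < p.T)
    (hμ : 0 < μ)
    (hBV : BVBound p μ)
    (hΞ : ClosedAround (D.Ξx ×ˢ D.ΞT) (p.x p.T, p.T)) :
    (∃ ε₀ : ℝ, 0 < ε₀ ∧ ∀ ε : ℝ, 0 < ε → ε ≤ ε₀ →
      ∀ᶠ k : ℕ in atTop, HasOptimalSolution D p Lf Lν μ ε k) ∧
    (IsClosed D.Ξx → IsClosed D.ΞT → ∀ ε : ℝ, 0 < ε → ε < p.T →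
      ∀ᶠ k : ℕ in atTop, HasOptimalSolution D p Lf Lν μ ε k) := by
  obtain ⟨K, hK⟩ := exists_tameReference hp hμ hBV
  have hK0 : 0 ≤ K := (norm_nonneg _).trans (hK.state.bound 0 le_rfl)
  have hC := hg.isClosed_C
  have hfc := hf.continuous
  have hνc : ∀ i, Continuous (D.ν i) := fun i => (hν.smooth i).continuous
  have hfeas : ∀ ε : ℝ, 0 < ε → ∀ᶠ k : ℕ in atTop,
      ∃ z : DiscreteProcess n d k, z.Feasible D p Lf Lν μ ε := fun ε hε =>
    eventually_exists_feasible hp hK hBV hμ hT hC hfc hf hν hA.compact.isClosed hε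
  constructor
  · obtain ⟨r, hr, hx, ht⟩ := hΞ.exists_closed_factors hp.endpoint hp.endtime
    -- The budget for the endpoint is `r`: at most `r / 6` from the term with `lam`, `r / 6` from
    -- the terms linear in `ε`, and `r / 2` from `muX`.
    set lam := r / (12 * p.T) with hlam_def
    have hlam : 0 < lam := by positivity
    have hlamT : lam * (p.T + p.T) = r / 6 := by rw [hlam_def]; field_simp; norm_num
    -- The three entries ensure `ε < p.T`, localize the final time together with `muX < r / 2`, and
    -- bound the terms linear in `ε` by `r / 6`.
    refine ⟨min (p.T / 2) (min (r / 2) (r / 6 * (lam⁻¹ / 2 + K)⁻¹)), by positivity,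
      fun ε hε hε₀ => ?_⟩
    have hεT : ε < p.T := by linarith [hε₀.trans (min_le_left _ _)]
    have hεr : ε ≤ r / 2 := hε₀.trans ((min_le_right _ _).trans (min_le_left _ _))
    have hεK : lam⁻¹ * (ε / 2) + K * ε ≤ r / 6 := by
      have := hε₀.trans ((min_le_right _ _).trans (min_le_right _ _))
      rw [← div_eq_mul_inv, le_div_iff₀ (by positivity)] at this
      linarith
    filter_upwards [hfeas ε hε, eventually_gt_atTop 0,
      (tendsto_muX Lf μ p.T).eventually (gt_mem_nhds (half_pos hr))] with k hne hk hmu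
    refine exists_minimizer_of_feasible hK hp.initial hk hεT hC hfc hνc hA.compact hx ht
      inter_subset_left inter_subset_left (fun z hz => ⟨?_, ?_⟩) hne
      (lowerSemicontinuousOn_cost hK hk hcost fun _ h => h)
    · refine mem_inter_closedBall_add hz.endpoint
        (norm_endpoint_sub_le hK hp.initial hk hz hlam) ?_
      have : lam * (p.T + ε) ≤ lam * (p.T + p.T) := by gcongr
      linarith
    · exact mem_inter_closedBall_add hz.endtime hz.time_local (by linarith)
  · intro hx ht ε hε hεT
    filter_upwards [hfeas ε hε, eventually_gt_atTop 0] with k hne hk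
    exact exists_minimizer_of_feasible hK hp.initial hk hεT hC hfc hνc hA.compact hx ht
      Subset.rfl Subset.rfl (fun z hz => ⟨hz.endpoint, hz.endtime⟩) hne
      (lowerSemicontinuousOn_cost hK hk hcost fun _ h => h)
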